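/- Let $\mathbb D=\{z\in\mathbb C:|z|<1\}$. Let $\phi$ be analytic and univalent on $\mathbb D$ with $\operatorname{Re}\phi>0$, $\phi(0)=1$, $\phi'(0)>0$ and $\phi(\mathbb D)$ symmetric about the real axis, and suppose that $\phi(\mathbb D)$ is convex. Write $\phi(z)=1+B_1z+B_2z^2+\cdots$. Let $\psi$ be an analytic zero-free function on $\mathbb D$ with $$\psi(z)+\frac{z\psi'(z)}{\psi(z)}=\phi(z)\quad(z\in\mathbb D),\qquad \psi(z)=1+\sum_{m\ge1}c_mz^m .$$ Let $\mathcal C(\phi)$ be the class of analytic $f$ on $\mathbb D$ with $f(0)=0$, $f'(0)=1$, $f'\ne0$ and $1+zf''(z)/f'(z)\prec\phi(z)$, where $g\prec F$ means $g=F\circ w$ on $\mathbb D$ for some analytic $w:\mathbb D\to\mathbb D$ with $w(0)=0$. The logarithmic coefficients $\gamma_m=\gamma_m(f)$ are given by $\log\big(f(z)/z\big)=2\sum_{m\ge1}\gamma_mz^m$ near $0$, with the branch of the logarithm that vanishes at $z=0$. (1) If $\psi(\mathbb D)$ is convex, then every $f\in\mathcal C(\phi)$ satisfies $$|\gamma_m|\le\frac{|B_1|}{4m}\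 (m\ge1),\qquad \sum_{m=1}^{n}|\gamma_m|^2\le\frac14\sum_{m=1}^{n}\frac{|c_m|^2}{m^2}\ (n\in\mathbb N),\qquad \sum_{m=1}^{\infty}|\gamma_m|^2\le\frac14\sum_{m=1}^{\infty}\frac{|c_m|^2}{m^2},$$ where both infinite series converge. (2) If $\psi(\mathbb D)$ is starlike with respect to $1$, then every $f\in\mathcal C(\phi)$ satisfies $|\gamma_m|\le |B_1|/4$ for all $m\ge1$. (3) (Sharpness.) There is an analytic $f_0$ on $\mathbb D$ with $f_0(0)=0$, $f_0'(0)=1$, $f_0(z)\neq0$ for $z\ne0$, and $zf_0'(z)/f_0(z)=\psi(z)$ for $0<|z|<1$. Every such $f_0$ belongs to $\mathcal C(\phi)$ and has $\gamma_m(f_0)=c_m/(2m)$ for all $m\ge1$. In case (1), $f_0$ gives equality in the inequality between the infinite sums and in $|\gamma_m|\le|B_1|/(4m)$ for $m=1$, and for a given $m\ge1$ it gives equality in the latter exactly when $|c_m|=|B_1|/2$. In case (2), $f_0$ gives equality in $|\gamma_m|\le|B_1|/4$ for $m=1$, and for a given $m\ge1$ exactly when $|c_m|=m|B_1|/2$.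 -/

import Mathlib

noncomputable section

namespace MaMinda

/-- The open unit disk. -/
abbrev disk : Set ℂ := Metric.ball 0 1

/-- Subordination `g ≺ F` on the unit disk: `g = F ∘ w` for a Schwarz function `w`. -/
def Subordinate (g F : ℂ → ℂ) : Prop :=
  ∃ w : ℂ → ℂ, DifferentiableOn ℂ w disk ∧ w 0 = 0 ∧ (∀ z ∈ disk, w z ∈ disk) ∧
    ∀ z ∈ disk, g z = F (w z)

/-- The class of analytic functions on the disk normalized by `f 0 = 0`, `f' 0 = 1`. -/
structure Normalized (f : ℂ → ℂ) : Prop where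
  analytic : DifferentiableOn ℂ f disk
  map_zero : f 0 = 0
  deriv_zero : deriv f 0 = 1

/-- Ma-Minda functions: analytic and univalent on the disk, with positive real part, value `1`
and positive derivative at the origin, and image symmetric about the real axis. -/
structure IsMaMinda (φ : ℂ → ℂ) : Prop where
  analytic : DifferentiableOn ℂ φ disk
  univalent : Set.InjOn φ disk
  re_pos : ∀ z ∈ disk, 0 < (φ z).re
  map_zero : φ 0 = 1
  deriv_zero_re : 0 < (deriv φ 0).re
  deriv_zero_im : (deriv φ 0).im = 0
  symmetric : ∀ u ∈ φ '' disk, (starRingEnd ℂ) u ∈ φ '' disk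

/-- The Ma-Minda class of convex functions: normalized `f` with
`1 + z f''(z) / f'(z) ≺ φ(z)`, the quotient being required to make sense on the disk. -/
structure ConvexClass (φ f : ℂ → ℂ) : Prop where
  normalized : Normalized f
  deriv_ne_zero : ∀ z ∈ disk, deriv f z ≠ 0
  subordinate : Subordinate (fun z => 1 + z * deriv (deriv f) z / deriv f z) φ

/-- `ψ` is an analytic solution on the disk of `ψ + z ψ' / ψ = φ`. -/
structure BriotBouquetSolution (φ ψ : ℂ → ℂ) : Prop where
  analytic : DifferentiableOn ℂ ψ disk
  ne_zero : ∀ z ∈ disk, ψ z ≠ 0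
  equation : ∀ z ∈ disk, ψ z + z * deriv ψ z / ψ z = φ z

/-- `f` is a normalized analytic function with `z f' / f = ψ` on the punctured disk. -/
structure StarSolution (ψ f : ℂ → ℂ) : Prop where
  normalized : Normalized f
  ne_zero : ∀ z ∈ disk, z ≠ 0 → f z ≠ 0
  equation : ∀ z ∈ disk, z ≠ 0 → z * deriv f z / f z = ψ z

/-- The `m`-th Taylor coefficient at the origin. -/
def taylorCoeff (g : ℂ → ℂ) (m : ℕ) : ℂ := iteratedDeriv m g 0 / (m.factorial : ℂ)

/-- The `m`-th logarithmic coefficient `γ_m`, determined by `log (f z / z) = 2 ∑ γ_m z ^ m` near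
the origin. For normalized `f`, the function `dslope f 0` is `z ↦ f z / z` with the singularity
removed (value `1` at `0`), and the logarithm is the branch with `log 1 = 0`. -/
def logCoeff (f : ℂ → ℂ) (m : ℕ) : ℂ := taylorCoeff (fun z => Complex.log (dslope f 0 z)) m / 2

end MaMinda

end

open MaMinda

namespace MaMinda

open Set Metric Filter Topology

/-! ### Boundary derivative estimates -/

/-! Everything rests on one subordination: for `f` in the convex class, `z f' / f = ψ ∘ ω` with a
Schwarz function `ω` (`exists_schwarz_of_convexClass`). Since `z (log (f z / z))' = z f' / f - 1`,
the coefficient `γ_m` is the `m`-th Taylor coefficient of `ψ ∘ ω` divided by `2 m`. The bounds thus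
become statements about functions subordinate to `ψ`, and `ω = id` is the extremal case.

Subordinations are obtained from `exists_schwarz`. Where `‖F⁻¹ ∘ g‖` is maximal on a closed disk,
Jack's lemma gives a contact relation `g z = F ζ`, `z g' z = k ζ F' ζ` with `k ≥ 1`, and only `‖ζ‖ >
‖z‖` has to be excluded. Convexity of the image of `φ` enters as the sign of the real part of `(φ z
- φ ζ) / (ζ φ' ζ)` for `‖z‖ ≤ ‖ζ‖`, with a strict form for `‖z‖ < ‖ζ‖`.

The criterion needs a univalent target, and univalence of `ψ` has to be proved (`injOn`). In the
chain `(1 - t) ψ + t φ` the roots of an equation with fixed right-hand side move inward as `t`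
grows, so a coincidence `ψ z₁ = ψ z₂` would survive until `t = 1` and contradict univalence of `φ`.

For the coefficients, Rogosinski's inequality (`sqSum_comp_le`) and Abel summation bound the sums of
squares. Averaging over roots of unity treats convex images. For starlike images a square root
subordinate to `1 / (1 - z)` splits the function into two factors controlled by Rogosinski's
inequality. The constants come from `2 ψ'(0) = φ'(0)`. -/

theorem deriv_nonpos_of_eventually_le_right {f : ℝ → ℝ} {d x : ℝ} (h : HasDerivAt f d x)
    (hle : ∀ᶠ s in 𝓝[>] x, f s ≤ f x) : d ≤ 0 := by
  have ht : Tendsto (slope f x) (𝓝[>] x) (𝓝 d) :=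
    (hasDerivAt_iff_tendsto_slope.1 h).mono_left
      (nhdsWithin_mono x fun y hy => ne_of_gt hy)
  refine le_of_tendsto ht ?_
  filter_upwards [hle, self_mem_nhdsWithin] with s hs hs'
  rw [slope_def_field]
  exact div_nonpos_of_nonpos_of_nonneg (by linarith) (by linarith [mem_Ioi.1 hs'])

theorem re_conj_mul_deriv_le {x : ℝ → ℂ} {v : ℂ} {b : ℝ → ℝ} {b' : ℝ} (hx : HasDerivAt x v 0)
    (hb : HasDerivAt b b' 0) (hb0 : b 0 = 1)
    (hle : ∀ᶠ s in 𝓝[>] (0 : ℝ), ‖x s‖ ≤ ‖x 0‖ * b s) :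
    ((starRingEnd ℂ) (x 0) * v).re ≤ ‖x 0‖ ^ 2 * b' := by
  have h1 := hx.norm_sq
  have h2 := (hb.const_mul ‖x 0‖).pow 2
  have h3 := deriv_nonpos_of_eventually_le_right (h1.sub h2) (by
    filter_upwards [hle] with s hs
    simp only [Pi.sub_apply, Pi.pow_apply, hb0, mul_one, sub_self, sub_nonpos]
    exact pow_le_pow_left₀ (norm_nonneg _) hs 2)
  rw [Complex.inner, hb0] at h3
  simp only [Nat.cast_ofNat, mul_one, Nat.add_one_sub_one, pow_one] at h3
  rw [mul_comm v] at h3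
  nlinarith

/-- **Jack's lemma**. -/
theorem exists_real_mul_eq_of_norm_le {ω : ℂ → ℂ} {s : ℝ} {z₀ : ℂ}
    (hω : DifferentiableOn ℂ ω (ball 0 s)) (h0 : ω 0 = 0) (hz₀ : z₀ ≠ 0) (hz₀s : ‖z₀‖ < s)
    (hne : ω z₀ ≠ 0) (hmax : ∀ z, ‖z‖ ≤ ‖z₀‖ → ‖ω z‖ ≤ ‖ω z₀‖) :
    ∃ k : ℝ, 1 ≤ k ∧ z₀ * deriv ω z₀ = k * ω z₀ := by
  have hd : HasDerivAt ω (deriv ω z₀) z₀ :=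
    (hω.differentiableAt (isOpen_ball.mem_nhds (by simpa using hz₀s))).hasDerivAt
  have hpos : 0 < ‖z₀‖ := norm_pos_iff.2 hz₀
  have hrad : ∀ c : ℂ, HasDerivAt (fun τ : ℝ => z₀ * Complex.exp (c * τ)) (z₀ * c) 0 := by
    intro c
    have h1 : HasDerivAt (fun τ : ℂ => z₀ * Complex.exp (c * τ)) (z₀ * c) ((0 : ℝ) : ℂ) := by
      have := (((hasDerivAt_id ((0 : ℝ) : ℂ)).const_mul c).cexp).const_mul z₀
      simpa using this
    exact h1.comp_ofReal
  have hcurve : ∀ c : ℂ, HasDerivAt (fun τ : ℝ => ω (z₀ * Complex.exp (c * τ)))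
      (deriv ω z₀ * (z₀ * c)) 0 := by
    intro c
    have : HasDerivAt ω (deriv ω z₀) (z₀ * Complex.exp (c * ((0 : ℝ) : ℂ))) := by simpa using hd
    exact this.comp (0 : ℝ) (hrad c)
  -- For `τ > 0` the curve `z₀ exp (c τ)` stays in the closed disk of radius `‖z₀‖`. The Schwarz
  -- lemma there (or just maximality if `c.re = 0`) bounds `‖ω‖` along it by `‖ω z₀‖ exp (c.re τ)`;
  -- the two sides are compared to first order at `τ = 0`.
  have key : ∀ c : ℂ, c.re ≤ 0 →
      ((starRingEnd ℂ) (ω z₀) * (deriv ω z₀ * (z₀ * c))).re ≤ ‖ω z₀‖ ^ 2 * c.re := by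
    intro c hc
    have hb : HasDerivAt (fun τ : ℝ => Real.exp (c.re * τ)) c.re 0 := by
      have := ((hasDerivAt_id (0 : ℝ)).const_mul c.re).exp
      simpa using this
    have := re_conj_mul_deriv_le (hcurve c) hb (by simp) (by
      filter_upwards [self_mem_nhdsWithin] with τ hτ
      have hτ : 0 < τ := hτ
      have hn : ‖z₀ * Complex.exp (c * τ)‖ = ‖z₀‖ * Real.exp (c.re * τ) := by
        rw [norm_mul, Complex.norm_exp]; simp
      simp only [Complex.ofReal_zero, mul_zero, Complex.exp_zero, mul_one]
      rcases hc.lt_or_eq with hc | hc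
      · have hlt : Real.exp (c.re * τ) < 1 := by
          rw [Real.exp_lt_one_iff]; exact mul_neg_of_neg_of_pos hc hτ
        have := Complex.dist_le_div_mul_dist_of_mapsTo_ball (f := ω) (c := 0) (R₁ := ‖z₀‖)
          (R₂ := ‖ω z₀‖) (z := z₀ * Complex.exp (c * τ))
          (hω.mono (ball_subset_ball hz₀s.le))
          (by
            intro z hz
            rw [h0, mem_closedBall_zero_iff]
            exact hmax z (by simpa using (mem_ball_zero_iff.1 hz).le))
          (by rw [mem_ball_zero_iff, hn]; nlinarith)
        rw [h0, dist_zero_right, dist_zero_right, hn] at this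
        refine this.trans (le_of_eq ?_)
        field_simp
      · have : ‖z₀ * Complex.exp (c * τ)‖ = ‖z₀‖ := by rw [hn, hc]; simp
        rw [hc]
        simpa using hmax _ this.le)
    simpa using this
  set m : ℂ := (starRingEnd ℂ) (ω z₀) * (deriv ω z₀ * z₀) with hm
  have e : ∀ c : ℂ, (starRingEnd ℂ) (ω z₀) * (deriv ω z₀ * (z₀ * c)) = m * c := by
    intro c; rw [hm]; ring
  -- The radial direction gives `‖ω z₀‖ ^ 2 ≤ m.re`; the two opposite tangential directions force
  -- `m.im = 0`.
  have k1 := key (-1) (by simp)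
  have k2 := key Complex.I (by simp)
  have k3 := key (-Complex.I) (by simp)
  rw [e] at k1 k2 k3
  simp at k1 k2 k3
  have hn : 0 < ‖ω z₀‖ := norm_pos_iff.2 hne
  refine ⟨m.re / ‖ω z₀‖ ^ 2, (one_le_div (by positivity)).2 (by linarith), ?_⟩
  have him : m = (m.re : ℂ) := by
    apply Complex.ext <;> simp; linarith
  have hcc : (starRingEnd ℂ) (ω z₀) * ω z₀ = ((‖ω z₀‖ ^ 2 : ℝ) : ℂ) := by
    rw [mul_comm, Complex.mul_conj, Complex.normSq_eq_norm_sq]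
  have hc0 : (starRingEnd ℂ) (ω z₀) ≠ 0 := by simpa using hne
  apply mul_left_cancel₀ hc0
  have hnc : ((‖ω z₀‖ ^ 2 : ℝ) : ℂ) ≠ 0 := by exact_mod_cast (by positivity : ‖ω z₀‖ ^ 2 ≠ 0)
  rw [show (starRingEnd ℂ) (ω z₀) * (z₀ * deriv ω z₀) = m by rw [hm]; ring,
    show (starRingEnd ℂ) (ω z₀) * (((m.re / ‖ω z₀‖ ^ 2 : ℝ) : ℂ) * ω z₀)
      = ((m.re / ‖ω z₀‖ ^ 2 : ℝ) : ℂ) * ((starRingEnd ℂ) (ω z₀) * ω z₀) by ring, hcc, him,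
    ← Complex.ofReal_mul]
  congr 1
  field_simp
  simp

/-! ### Univalent functions -/

/-- At a critical point `F - F a` is locally `χ ^ n` with `n ≥ 2` and `χ` a local homeomorphism
vanishing at `a`. Then `χ` takes two values differing by a primitive `n`-th root of unity, at points
where `F` agrees. -/
theorem deriv_ne_zero_of_injOn {F : ℂ → ℂ} {U : Set ℂ} (hU : IsOpen U)
    (hF : DifferentiableOn ℂ F U) (hinj : InjOn F U) {a : ℂ} (ha : a ∈ U) : deriv F a ≠ 0 := by
  intro hder
  have hUa := hU.mem_nhds ha
  have hA : AnalyticAt ℂ F a := hF.analyticAt hUa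
  have hB : AnalyticAt ℂ (fun z => F z - F a) a := hA.sub analyticAt_const
  have hnz : ¬ ∀ᶠ z in 𝓝 a, F z - F a = 0 := by
    intro h
    have h1 : ∀ᶠ z in 𝓝[≠] a, False := by
      filter_upwards [h.filter_mono nhdsWithin_le_nhds, mem_nhdsWithin_of_mem_nhds hUa,
        self_mem_nhdsWithin] with z hz hzU hne
      exact hne (hinj hzU ha (sub_eq_zero.1 hz))
    exact h1.exists.elim fun _ h => h
  obtain ⟨n, g, hg, hga, hfg⟩ := hB.exists_eventuallyEq_pow_smul_nonzero_iff.2 hnz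
  have hn2 : 2 ≤ n := by
    rcases n with _ | _ | n
    · have := hfg.self_of_nhds
      simp at this
      exact absurd this.symm hga
    · have h1 : HasDerivAt (fun z => (z - a) ^ 1 • g z) (g a) a := by
        have := ((hasDerivAt_id a).sub_const a).fun_mul hg.differentiableAt.hasDerivAt
        simpa using this
      have h2 := (h1.congr_of_eventuallyEq hfg).unique
        (hA.differentiableAt.hasDerivAt.sub_const (F a))
      exact absurd (h2.trans hder) hga
    · omega
  have hn0 : (n : ℂ) ≠ 0 := by exact_mod_cast (by omega : n ≠ 0)
  obtain ⟨c, hc⟩ : ∃ c : ℂ, c ^ n = g a := IsAlgClosed.exists_pow_nat_eq _ (by omega)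
  have hc0 : c ≠ 0 := by rintro rfl; rw [zero_pow (by omega)] at hc; exact hga hc.symm
  set r : ℂ → ℂ := fun z => c * Complex.exp (Complex.log (g z / g a) / n) with hr
  have hrA : AnalyticAt ℂ r a := by
    refine analyticAt_const.mul (AnalyticAt.cexp ?_)
    refine AnalyticAt.div_const (AnalyticAt.clog (hg.div_const) ?_)
    simp [hga]
  have hrn : ∀ᶠ z in 𝓝 a, r z ^ n = g z := by
    filter_upwards [hg.continuousAt.eventually_ne hga] with z hz
    simp only [hr]
    rw [mul_pow, hc, ← Complex.exp_nat_mul, mul_div_cancel₀ _ hn0,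
      Complex.exp_log (div_ne_zero hz hga), mul_div_cancel₀ _ hga]
  set χ : ℂ → ℂ := fun z => (z - a) * r z with hχ
  have hχA : AnalyticAt ℂ χ a := (analyticAt_id.sub analyticAt_const).mul hrA
  have hra : r a = c := by simp [hr, hga]
  have hχd : HasStrictDerivAt χ c a := by
    have h1 := hχA.hasStrictDerivAt
    have h2 := ((hasDerivAt_id a).sub_const a).mul hrA.differentiableAt.hasDerivAt
    simp [hra] at h2
    rwa [show deriv χ a = c from HasDerivAt.deriv h2] at h1
  have hmap := hχd.map_nhds_eq hc0
  have hχa : χ a = 0 := by simp [hχ]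
  have hgood : {z | z ∈ U ∧ F z - F a = χ z ^ n} ∈ 𝓝 a := by
    filter_upwards [hUa, hrn, hfg] with z h1 h2 h3
    refine ⟨h1, ?_⟩
    rw [h3, hχ]; simp only; rw [mul_pow, h2, smul_eq_mul]
  have himg : χ '' {z | z ∈ U ∧ F z - F a = χ z ^ n} ∈ 𝓝 (0 : ℂ) := by
    rw [← hχa, ← hmap]; exact image_mem_map hgood
  obtain ⟨ε, hε, hball⟩ := Metric.mem_nhds_iff.1 himg
  have hprim := Complex.isPrimitiveRoot_exp n (by omega)
  set ξ := Complex.exp (2 * Real.pi * Complex.I / n) with hξ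
  have hξn : ‖ξ‖ = 1 := hprim.norm'_eq_one (by omega)
  have hy : ((ε / 2 : ℝ) : ℂ) ∈ ball (0 : ℂ) ε := by
    rw [mem_ball_zero_iff, Complex.norm_real, Real.norm_eq_abs, abs_of_pos (by positivity)]
    linarith
  have hy' : ξ * ((ε / 2 : ℝ) : ℂ) ∈ ball (0 : ℂ) ε := by
    rw [mem_ball_zero_iff, norm_mul, hξn, one_mul]; simpa using hy
  obtain ⟨z₁, ⟨hz₁, e₁⟩, h₁⟩ := hball hy
  obtain ⟨z₂, ⟨hz₂, e₂⟩, h₂⟩ := hball hy'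
  have hFF : F z₁ = F z₂ := by
    rw [h₁] at e₁
    rw [h₂, mul_pow, hprim.pow_eq_one, one_mul, ← e₁] at e₂
    exact (sub_left_injective e₂).symm
  have hzz := hinj hz₁ hz₂ hFF
  rw [← hzz, h₁] at h₂
  have hε2 : ((ε / 2 : ℝ) : ℂ) ≠ 0 := by exact_mod_cast (by positivity : ε / 2 ≠ 0)
  have : ξ = 1 := by
    have : (ξ - 1) * ((ε / 2 : ℝ) : ℂ) = 0 := by rw [sub_mul, ← h₂, one_mul, sub_self]
    rcases mul_eq_zero.1 this with h | h
    · exact sub_eq_zero.1 h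
    · exact absurd h hε2
  exact hprim.ne_one (by omega) this

/-- The hypothesis that `F` is analytic and injective on the unit disk. -/
structure Univalent (F : ℂ → ℂ) : Prop where
  analytic : DifferentiableOn ℂ F disk
  inj : InjOn F disk

/-- The inverse of a univalent function, defined on its image. -/
noncomputable def inverse (F : ℂ → ℂ) : ℂ → ℂ := Function.invFunOn F disk

theorem zero_mem_disk : (0 : ℂ) ∈ disk := mem_ball_self one_pos

theorem mem_disk {z : ℂ} : z ∈ disk ↔ ‖z‖ < 1 := mem_ball_zero_iff

theorem differentiableAt_of_mem_disk {g : ℂ → ℂ} (hg : DifferentiableOn ℂ g disk) {z : ℂ}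
    (hz : z ∈ disk) : DifferentiableAt ℂ g z :=
  hg.differentiableAt (isOpen_ball.mem_nhds hz)

namespace Univalent

variable {F : ℂ → ℂ} (hF : Univalent F)
include hF

theorem deriv_ne_zero {z : ℂ} (hz : z ∈ disk) : deriv F z ≠ 0 :=
  deriv_ne_zero_of_injOn isOpen_ball hF.analytic hF.inj hz

theorem hasStrictDerivAt {z : ℂ} (hz : z ∈ disk) : HasStrictDerivAt F (deriv F z) z :=
  (hF.analytic.analyticAt (isOpen_ball.mem_nhds hz)).hasStrictDerivAt

theorem image_mem_nhds {z : ℂ} {V : Set ℂ} (hz : z ∈ disk) (hV : V ∈ 𝓝 z) : F '' V ∈ 𝓝 (F z) := by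
  rw [← (hF.hasStrictDerivAt hz).map_nhds_eq (hF.deriv_ne_zero hz)]
  exact image_mem_map hV

theorem isOpen_image : IsOpen (F '' disk) := by
  rw [isOpen_iff_mem_nhds]
  rintro _ ⟨z, hz, rfl⟩
  exact hF.image_mem_nhds hz (isOpen_ball.mem_nhds hz)

theorem inverse_apply {z : ℂ} (hz : z ∈ disk) : inverse F (F z) = z :=
  hF.inj (Function.invFunOn_mem ⟨z, hz, rfl⟩) hz (Function.invFunOn_eq ⟨z, hz, rfl⟩)

omit hF in
theorem inverse_mem {y : ℂ} (hy : y ∈ F '' disk) : inverse F y ∈ disk :=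
  Function.invFunOn_mem hy

omit hF in
theorem apply_inverse {y : ℂ} (hy : y ∈ F '' disk) : F (inverse F y) = y :=
  Function.invFunOn_eq hy

theorem hasDerivAt_inverse {z : ℂ} (hz : z ∈ disk) :
    HasDerivAt (inverse F) (deriv F z)⁻¹ (F z) := by
  have hc : ContinuousAt (inverse F) (F z) := by
    intro V hV
    rw [hF.inverse_apply hz] at hV
    rw [mem_map]
    filter_upwards [hF.image_mem_nhds hz (inter_mem hV (isOpen_ball.mem_nhds hz))]
    rintro _ ⟨x, ⟨hxV, hx⟩, rfl⟩
    rwa [mem_preimage, hF.inverse_apply hx]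
  refine HasDerivAt.of_local_left_inverse (f := F) hc ?_ (hF.deriv_ne_zero hz) ?_
  · rw [hF.inverse_apply hz]; exact (hF.hasStrictDerivAt hz).hasDerivAt
  · filter_upwards [hF.isOpen_image.mem_nhds ⟨z, hz, rfl⟩] with y hy using apply_inverse hy

theorem differentiableOn_inverse : DifferentiableOn ℂ (inverse F) (F '' disk) := by
  rintro _ ⟨z, hz, rfl⟩
  exact (hF.hasDerivAt_inverse hz).differentiableAt.differentiableWithinAt

end Univalent

/-! ### Subordination to a univalent function -/

theorem exists_maximal_point {ω : ℂ → ℂ} {s : ℝ} {z : ℂ} (hω : DifferentiableOn ℂ ω (ball 0 s))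
    (h0 : ω 0 = 0) (hz : ‖z‖ < s) (hne : ω z ≠ 0) :
    ∃ z₀, z₀ ≠ 0 ∧ ‖z₀‖ ≤ ‖z‖ ∧ ‖ω z‖ ≤ ‖ω z₀‖ ∧ ω z₀ ≠ 0 ∧
      ∃ k : ℝ, 1 ≤ k ∧ z₀ * deriv ω z₀ = k * ω z₀ := by
  have hc : ContinuousOn (fun x => ‖ω x‖) (closedBall 0 ‖z‖) :=
    (hω.continuousOn.mono (closedBall_subset_ball hz)).norm
  obtain ⟨z₀, hz₀, hmax⟩ := (isCompact_closedBall (0 : ℂ) ‖z‖).exists_isMaxOn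
    ⟨z, by simp⟩ hc
  rw [mem_closedBall_zero_iff] at hz₀
  have hle : ‖ω z‖ ≤ ‖ω z₀‖ := hmax (by simp : z ∈ closedBall (0 : ℂ) ‖z‖)
  have hne₀ : ω z₀ ≠ 0 := norm_pos_iff.1 ((norm_pos_iff.2 hne).trans_le hle)
  have hz₀0 : z₀ ≠ 0 := by rintro rfl; exact hne₀ h0
  refine ⟨z₀, hz₀0, hz₀, hle, hne₀,
    exists_real_mul_eq_of_norm_le hω h0 hz₀0 (hz₀.trans_lt hz) hne₀ fun x hx => ?_⟩
  exact hmax (by simpa using hx.trans hz₀ : x ∈ closedBall (0 : ℂ) ‖z‖)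

namespace Univalent

variable {F : ℂ → ℂ} (hF : Univalent F)
include hF

/-- Jack's lemma at a maximum of `‖F⁻¹ ∘ g‖` supplies the data for `H`, and the bound at that point
carries over to `z`. The radius `s` is kept free because `exists_schwarz` uses this before knowing
that `g` maps the whole disk into the image of `F`. -/
theorem norm_inverse_comp_le {g : ℂ → ℂ} {s : ℝ} (hs : s ≤ 1) (hg : DifferentiableOn ℂ g disk)
    (h0 : g 0 = F 0) (hmaps : MapsTo g (ball 0 s) (F '' disk))
    (H : ∀ z ζ : ℂ, ∀ k : ℝ, z ∈ disk → ζ ∈ disk → z ≠ 0 → ζ ≠ 0 → 1 ≤ k → g z = F ζ →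
      z * deriv g z = k * (ζ * deriv F ζ) → ‖ζ‖ ≤ ‖z‖) {z : ℂ} (hz : ‖z‖ < s) :
    ‖inverse F (g z)‖ ≤ ‖z‖ := by
  set ω : ℂ → ℂ := fun x => inverse F (g x) with hω
  have hsub : ball (0 : ℂ) s ⊆ disk := ball_subset_ball hs
  have hd : DifferentiableOn ℂ ω (ball 0 s) := hF.differentiableOn_inverse.comp (hg.mono hsub) hmaps
  have hω0 : ω 0 = 0 := by simp only [hω]; rw [h0, hF.inverse_apply zero_mem_disk]
  by_cases hne : ω z = 0
  · rw [← hω] at *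
    change ‖ω z‖ ≤ ‖z‖
    rw [hne]; simp
  obtain ⟨z₀, hz₀0, hz₀, hle, hne₀, k, hk, hkeq⟩ := exists_maximal_point hd hω0 hz hne
  have hz₀s : z₀ ∈ ball (0 : ℂ) s := by rw [mem_ball_zero_iff]; exact hz₀.trans_lt hz
  have hωz₀ : ω z₀ ∈ disk := inverse_mem (hmaps hz₀s)
  have hgF : g z₀ = F (ω z₀) := (apply_inverse (hmaps hz₀s)).symm
  have hder : HasDerivAt g (deriv F (ω z₀) * deriv ω z₀) z₀ := by
    have h1 := (hF.hasStrictDerivAt hωz₀).hasDerivAt.comp z₀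
      (hd.differentiableAt (isOpen_ball.mem_nhds hz₀s)).hasDerivAt
    refine h1.congr_of_eventuallyEq ?_
    filter_upwards [isOpen_ball.mem_nhds hz₀s] with x hx
    exact (apply_inverse (hmaps hx)).symm
  refine hle.trans ((H z₀ (ω z₀) k (hsub hz₀s) hωz₀ hz₀0 hne₀ hk hgF ?_).trans hz₀)
  rw [hder.deriv]
  linear_combination deriv F (ω z₀) * hkeq

/-- A criterion for subordination of Miller–Mocanu type. -/
theorem exists_schwarz {g : ℂ → ℂ} (hg : DifferentiableOn ℂ g disk) (h0 : g 0 = F 0)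
    (H : ∀ z ζ : ℂ, ∀ k : ℝ, z ∈ disk → ζ ∈ disk → z ≠ 0 → ζ ≠ 0 → 1 ≤ k → g z = F ζ →
      z * deriv g z = k * (ζ * deriv F ζ) → ‖ζ‖ ≤ ‖z‖) :
    ∃ ω : ℂ → ℂ, DifferentiableOn ℂ ω disk ∧ ω 0 = 0 ∧ (∀ z ∈ disk, ‖ω z‖ ≤ ‖z‖) ∧
      ∀ z ∈ disk, g z = F (ω z) := by
  have hmaps : MapsTo g disk (F '' disk) := by
    by_contra hcon
    simp only [MapsTo, not_forall] at hcon
    obtain ⟨z₁, hz₁, hbad⟩ := hcon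
    rw [mem_disk] at hz₁
    have hsub : closedBall (0 : ℂ) ‖z₁‖ ⊆ disk := closedBall_subset_ball hz₁
    have hcl : IsClosed (closedBall (0 : ℂ) ‖z₁‖ ∩ g ⁻¹' (F '' disk)ᶜ) :=
      (hg.continuousOn.mono hsub).preimage_isClosed_of_isClosed isClosed_closedBall
        hF.isOpen_image.isClosed_compl
    have hcpt := (isCompact_closedBall (0 : ℂ) ‖z₁‖).of_isClosed_subset hcl inter_subset_left
    -- A point of least modulus at which `g` leaves the image. On smaller moduli the norm bound
    -- holds, so along the radius to `z` the values of `g` lie in the compact set `F '' closedBall 0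
    -- ‖z‖`, and so does the limit `g z`.
    obtain ⟨z, ⟨hz, hzbad⟩, hmin⟩ := hcpt.exists_isMinOn ⟨z₁, by simp, hbad⟩
      continuous_norm.continuousOn
    rw [mem_closedBall_zero_iff] at hz
    have hz1 : ‖z‖ < 1 := hz.trans_lt hz₁
    have hmapsz : MapsTo g (ball 0 ‖z‖) (F '' disk) := by
      intro x hx
      rw [mem_ball_zero_iff] at hx
      by_contra hxb
      have := hmin (show x ∈ closedBall (0 : ℂ) ‖z₁‖ ∩ g ⁻¹' (F '' disk)ᶜ from
        ⟨by simpa using hx.le.trans hz, hxb⟩)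
      exact absurd this (not_le.2 hx)
    have hcomp : IsCompact (F '' closedBall 0 ‖z‖) :=
      (isCompact_closedBall _ _).image_of_continuousOn
        (hF.analytic.continuousOn.mono (closedBall_subset_ball hz1))
    have hz0 : z ≠ 0 := by
      rintro rfl
      exact hzbad ⟨0, zero_mem_disk, h0.symm⟩
    have htend : Tendsto (fun t : ℝ => g (t * z)) (𝓝[<] 1) (𝓝 (g z)) := by
      have h1 : Tendsto (fun t : ℝ => (t : ℂ) * z) (𝓝[<] 1) (𝓝 z) := by
        have : Continuous (fun t : ℝ => (t : ℂ) * z) := by fun_prop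
        have := this.tendsto 1
        simp only [Complex.ofReal_one, one_mul] at this
        exact this.mono_left nhdsWithin_le_nhds
      exact (differentiableAt_of_mem_disk hg (mem_disk.2 hz1)).continuousAt.tendsto.comp h1
    have hmem : g z ∈ F '' closedBall 0 ‖z‖ := by
      refine hcomp.isClosed.mem_of_tendsto htend ?_
      filter_upwards [Ioo_mem_nhdsLT (zero_lt_one' ℝ)] with t ht
      have hlt : ‖(t : ℂ) * z‖ < ‖z‖ := by
        rw [norm_mul, Complex.norm_real, Real.norm_eq_abs, abs_of_pos ht.1]
        exact mul_lt_of_lt_one_left (norm_pos_iff.2 hz0) ht.2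
      refine ⟨inverse F (g (t * z)), ?_, apply_inverse (hmapsz (by simpa using hlt))⟩
      rw [mem_closedBall_zero_iff]
      exact (hF.norm_inverse_comp_le hz1.le hg h0 hmapsz H hlt).trans hlt.le
    exact hzbad (image_mono (closedBall_subset_ball hz1) hmem)
  refine ⟨fun z => inverse F (g z), hF.differentiableOn_inverse.comp hg hmaps, ?_, ?_, ?_⟩
  · simp only; rw [h0, hF.inverse_apply zero_mem_disk]
  · exact fun z hz => hF.norm_inverse_comp_le le_rfl hg h0 hmaps H (mem_disk.1 hz)
  · exact fun z hz => (apply_inverse (hmaps hz)).symm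

/-! ### Tangent directions of the image -/

/-- If moving the values of `F` towards those of `x ↦ F (η * x)` does not leave the image of `F`,
then the direction of this movement is not an outward one. -/
theorem re_sub_div_nonpos {η ζ : ℂ} (hη : ‖η‖ ≤ 1) (hζ : ζ ∈ disk) (hζ0 : ζ ≠ 0)
    (h : ∀ x ∈ disk, ∀ t : ℝ, 0 ≤ t → t ≤ 1 →
      (1 - t : ℂ) * F x + t * F (η * x) ∈ F '' disk) :
    ((F (η * ζ) - F ζ) / (ζ * deriv F ζ)).re ≤ 0 := by
  have hηm : ∀ x ∈ disk, η * x ∈ disk := by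
    intro x hx
    rw [mem_disk] at *
    rw [norm_mul]
    nlinarith [norm_nonneg x, norm_nonneg η]
  have hcurve : HasDerivAt (fun t : ℝ => (1 - t : ℂ) * F ζ + t * F (η * ζ))
      (F (η * ζ) - F ζ) 0 := by
    have h1 : HasDerivAt (fun t : ℂ => (1 - t : ℂ) * F ζ + t * F (η * ζ))
        (F (η * ζ) - F ζ) ((0 : ℝ) : ℂ) := by
      have := (((hasDerivAt_id ((0 : ℝ) : ℂ)).const_sub 1).mul_const (F ζ)).fun_add
        ((hasDerivAt_id ((0 : ℝ) : ℂ)).mul_const (F (η * ζ)))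
      refine this.congr_deriv ?_
      simp; ring
    exact h1.comp_ofReal
  have hx : HasDerivAt (fun t : ℝ => inverse F ((1 - t : ℂ) * F ζ + t * F (η * ζ)))
      ((deriv F ζ)⁻¹ * (F (η * ζ) - F ζ)) 0 := by
    have := hF.hasDerivAt_inverse hζ
    have h2 : HasDerivAt (inverse F) (deriv F ζ)⁻¹
        ((fun t : ℝ => (1 - t : ℂ) * F ζ + t * F (η * ζ)) 0) := by simpa using this
    exact h2.comp (0 : ℝ) hcurve
  have hx0 : inverse F ((1 - (0 : ℝ) : ℂ) * F ζ + (0 : ℝ) * F (η * ζ)) = ζ := by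
    simp [hF.inverse_apply hζ]
  -- For fixed `t`, pulling the moved values back by `F⁻¹` gives a self-map of the disk fixing `0`.
  -- By the Schwarz lemma the curve through `ζ` stays within `‖ζ‖`, so its velocity at `t = 0` is
  -- not outward.
  have := re_conj_mul_deriv_le hx (hasDerivAt_const (0 : ℝ) (1 : ℝ)) rfl (by
    filter_upwards [Ioo_mem_nhdsGT (zero_lt_one' ℝ)] with t ht
    rw [hx0, mul_one]
    refine Complex.norm_le_norm_of_mapsTo_ball (R := 1)
      (f := fun x => inverse F ((1 - t : ℂ) * F x + t * F (η * x))) ?_ ?_ ?_ (mem_disk.1 hζ)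
    · refine hF.differentiableOn_inverse.comp ?_ fun x hx => h x hx t ht.1.le ht.2.le
      refine (hF.analytic.const_mul _).add (DifferentiableOn.const_mul ?_ _)
      exact hF.analytic.comp (by fun_prop) hηm
    · exact fun x hx => ball_subset_closedBall (inverse_mem (h x hx t ht.1.le ht.2.le))
    · have : (1 - t : ℂ) * F 0 + t * F (η * 0) = F 0 := by rw [mul_zero]; ring
      rw [this, hF.inverse_apply zero_mem_disk])
  simp only [mul_zero, hx0] at this
  have hn : (0 : ℝ) < Complex.normSq ζ := Complex.normSq_pos.2 hζ0
  have e : (F (η * ζ) - F ζ) / (ζ * deriv F ζ)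
      = ((Complex.normSq ζ)⁻¹ : ℝ) * ((starRingEnd ℂ) ζ * ((deriv F ζ)⁻¹ * (F (η * ζ) - F ζ))) := by
    have h1 := Complex.mul_conj ζ
    have h2 := hF.deriv_ne_zero hζ
    have h3 : (Complex.normSq ζ : ℂ) ≠ 0 := by exact_mod_cast hn.ne'
    push_cast
    field_simp
    rw [← h1]
    ring
  rw [e, Complex.re_ofReal_mul]
  exact mul_nonpos_of_nonneg_of_nonpos (by positivity) this

theorem re_sub_div_nonpos_of_starConvex (hs : StarConvex ℝ (F 0) (F '' disk)) {ζ : ℂ}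
    (hζ : ζ ∈ disk) (hζ0 : ζ ≠ 0) : ((F 0 - F ζ) / (ζ * deriv F ζ)).re ≤ 0 := by
  have := hF.re_sub_div_nonpos (η := 0) (by simp) hζ hζ0 fun x hx t h0 h1 => by
    have := hs (mem_image_of_mem F hx) h0 (sub_nonneg.2 h1) (by ring)
    simp only [Complex.real_smul] at this
    push_cast at this
    rwa [zero_mul, add_comm]
  simpa using this

theorem re_sub_div_nonpos_of_convex (hs : Convex ℝ (F '' disk)) {z ζ : ℂ}
    (hζ : ζ ∈ disk) (hζ0 : ζ ≠ 0) (hz : ‖z‖ ≤ ‖ζ‖) :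
    ((F z - F ζ) / (ζ * deriv F ζ)).re ≤ 0 := by
  have hη : ‖z / ζ‖ ≤ 1 := by
    rw [norm_div]; exact div_le_one_of_le₀ hz (norm_nonneg _)
  have := hF.re_sub_div_nonpos (η := z / ζ) hη hζ hζ0 fun x hx t h0 h1 => by
    have hηx : z / ζ * x ∈ disk := by
      rw [mem_disk] at *
      rw [norm_mul]
      nlinarith [norm_nonneg x, norm_nonneg (z / ζ)]
    have := hs (mem_image_of_mem F hx) (mem_image_of_mem F hηx) (sub_nonneg.2 h1) h0 (by ring)
    simp only [Complex.real_smul] at this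
    push_cast at this
    exact this
  rwa [div_mul_cancel₀ _ hζ0] at this

/-- Strictness comes from openness: `F z` can be shifted slightly in the outward direction `ζ F' ζ`
and still be a value of `F` on the disk of radius `‖ζ‖`, where the weak inequality applies. -/
theorem re_sub_div_neg_of_convex (hs : Convex ℝ (F '' disk)) {z ζ : ℂ}
    (hζ : ζ ∈ disk) (hz : ‖z‖ < ‖ζ‖) :
    ((F z - F ζ) / (ζ * deriv F ζ)).re < 0 := by
  have hζ0 : ζ ≠ 0 := norm_pos_iff.1 ((norm_nonneg z).trans_lt hz)
  have hd : ζ * deriv F ζ ≠ 0 := mul_ne_zero hζ0 (hF.deriv_ne_zero hζ)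
  by_contra! hcon
  have hzd : z ∈ disk := mem_disk.2 (hz.trans (mem_disk.1 hζ))
  have hN := hF.image_mem_nhds hzd (isOpen_ball.mem_nhds (mem_ball_zero_iff.2 hz))
  have hT : Tendsto (fun δ : ℝ => F z + δ * (ζ * deriv F ζ)) (𝓝[>] 0) (𝓝 (F z)) := by
    have : Continuous (fun δ : ℝ => F z + δ * (ζ * deriv F ζ)) := by fun_prop
    have := this.tendsto 0
    simp only [Complex.ofReal_zero, zero_mul, add_zero] at this
    exact this.mono_left nhdsWithin_le_nhds
  obtain ⟨δ, ⟨x, hx, hxe⟩, hδ⟩ := ((hT.eventually hN).and self_mem_nhdsWithin).exists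
  have h1 := hF.re_sub_div_nonpos_of_convex hs hζ hζ0 (mem_ball_zero_iff.1 hx).le
  rw [hxe, show (F z + δ * (ζ * deriv F ζ) - F ζ) / (ζ * deriv F ζ)
    = (F z - F ζ) / (ζ * deriv F ζ) + δ by
      rw [add_sub_right_comm, add_div, mul_div_assoc, div_self hd, mul_one], Complex.add_re,
    Complex.ofReal_re] at h1
  have hδ : 0 < δ := hδ
  linarith

end Univalent

/-! ### The Briot–Bouquet equation -/

theorem IsMaMinda.toUnivalent {φ : ℂ → ℂ} (hφ : IsMaMinda φ) : Univalent φ :=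
  ⟨hφ.analytic, hφ.univalent⟩

theorem eventually_lt_of_deriv_neg {f : ℝ → ℝ} {d x : ℝ} (h : HasDerivAt f d x) (hd : d < 0) :
    ∀ᶠ s in 𝓝[>] x, f s < f x := by
  have ht : Tendsto (slope f x) (𝓝[>] x) (𝓝 d) :=
    (hasDerivAt_iff_tendsto_slope.1 h).mono_left
      (nhdsWithin_mono x fun y hy => ne_of_gt hy)
  filter_upwards [ht.eventually_lt_const hd, self_mem_nhdsWithin] with s hs hs'
  have hs' : x < s := hs'
  rw [slope_def_field, div_lt_iff₀ (by linarith)] at hs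
  linarith

theorem re_inv_pos {P : ℂ} (h : 0 < P.re) : 0 < (P⁻¹).re := by
  rw [Complex.inv_re]
  refine div_pos h (Complex.normSq_pos.2 ?_)
  rintro rfl
  simp at h

namespace BriotBouquetSolution

variable {φ ψ : ℂ → ℂ} (hψ : BriotBouquetSolution φ ψ)
include hψ

theorem map_zero : ψ 0 = φ 0 := by
  simpa using hψ.equation 0 zero_mem_disk

theorem mul_deriv {z : ℂ} (hz : z ∈ disk) : z * deriv ψ z = ψ z * (φ z - ψ z) := by
  have h1 := hψ.equation z hz
  have h2 := hψ.ne_zero z hz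
  rw [← h1]
  field_simp
  ring

/-- Differentiate `z ψ' = ψ (φ - ψ)` at the origin. This is the source of the factor `1 / 2`
relating `c_1` to `B_1`. -/
theorem two_mul_deriv_zero (hφ : DifferentiableOn ℂ φ disk) (h0 : φ 0 = 1) :
    2 * deriv ψ 0 = deriv φ 0 := by
  have dψ := (differentiableAt_of_mem_disk hψ.analytic zero_mem_disk).hasDerivAt
  have dφ := (differentiableAt_of_mem_disk hφ zero_mem_disk).hasDerivAt
  have ddψ := (differentiableAt_of_mem_disk (hψ.analytic.deriv isOpen_ball)
    zero_mem_disk).hasDerivAt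
  have h1 := (hasDerivAt_id (0 : ℂ)).fun_mul ddψ
  have h2 := dψ.fun_mul (dφ.fun_sub dψ)
  have h3 := h1.unique (h2.congr_of_eventuallyEq (by
    filter_upwards [isOpen_ball.mem_nhds zero_mem_disk] with z hz using hψ.mul_deriv hz))
  rw [hψ.map_zero, h0] at h3
  simp at h3
  linear_combination h3

variable (hφ : IsMaMinda φ) (hconv : Convex ℝ (φ '' disk))
include hφ hconv

/-- A solution of the Briot–Bouquet equation is strictly subordinate to the right-hand side. -/
theorem exists_norm_lt {z : ℂ} (hz : z ∈ disk) (hz0 : z ≠ 0) : ∃ w, ‖w‖ < ‖z‖ ∧ ψ z = φ w := by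
  have hU := hφ.toUnivalent
  have H : ∀ z ζ : ℂ, ∀ k : ℝ, z ∈ disk → ζ ∈ disk → z ≠ 0 → ζ ≠ 0 → 1 ≤ k → ψ z = φ ζ →
      z * deriv ψ z = k * (ζ * deriv φ ζ) → ‖ζ‖ < ‖z‖ := by
    intro z ζ k hz hζ hz0 hζ0 hk e1 e2
    by_contra! hle
    have h1 := hU.re_sub_div_nonpos_of_convex hconv hζ hζ0 hle
    have hd : ζ * deriv φ ζ ≠ 0 := mul_ne_zero hζ0 (hU.deriv_ne_zero hζ)
    have h3 : φ ζ ≠ 0 := by rw [← e1]; exact hψ.ne_zero z hz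
    -- At a contact point the differential equation makes this quotient `k / φ ζ`, whose real part
    -- is positive, against the convexity inequality `h1`.
    have e3 : (φ z - φ ζ) / (ζ * deriv φ ζ) = (k : ℝ) * (φ ζ)⁻¹ := by
      have := hψ.mul_deriv hz
      rw [e2, e1] at this
      rw [div_eq_iff hd]
      field_simp
      linear_combination -this
    rw [e3, Complex.re_ofReal_mul] at h1
    have := re_inv_pos (hφ.re_pos ζ hζ)
    nlinarith
  obtain ⟨ω, hω, hω0, hωle, hωe⟩ := hU.exists_schwarz hψ.analytic hψ.map_zero
    fun z ζ k a b c d e f g => (H z ζ k a b c d e f g).le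
  refine ⟨ω z, ?_, hωe z hz⟩
  by_cases hne : ω z = 0
  · rw [hne, norm_zero]; exact norm_pos_iff.2 hz0
  -- So far only `‖ω z‖ ≤ ‖z‖` is known. A second use of Jack's lemma, at a maximum of `‖ω‖`, makes
  -- the strict conclusion of `H` available.
  obtain ⟨z₀, hz₀0, hz₀, hle, hne₀, k, hk, hkeq⟩ :=
    exists_maximal_point hω hω0 (mem_disk.1 hz) hne
  have hz₀d : z₀ ∈ disk := mem_disk.2 (hz₀.trans_lt (mem_disk.1 hz))
  have hω₀ : ω z₀ ∈ disk := mem_disk.2 ((hωle z₀ hz₀d).trans_lt (mem_disk.1 hz₀d))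
  refine (hle.trans_lt (H z₀ (ω z₀) k hz₀d hω₀ hz₀0 hne₀ hk (hωe z₀ hz₀d) ?_)).trans_le hz₀
  have h1 := (hU.hasStrictDerivAt hω₀).hasDerivAt.comp z₀
      (differentiableAt_of_mem_disk hω hz₀d).hasDerivAt
  have h2 : HasDerivAt ψ (deriv φ (ω z₀) * deriv ω z₀) z₀ := by
    refine h1.congr_of_eventuallyEq ?_
    filter_upwards [isOpen_ball.mem_nhds hz₀d] with x hx using hωe x hx
  rw [h2.deriv]
  linear_combination deriv φ (ω z₀) * hkeq

theorem re_pos {z : ℂ} (hz : z ∈ disk) : 0 < (ψ z).re := by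
  by_cases hz0 : z = 0
  · rw [hz0, hψ.map_zero, hφ.map_zero]; simp
  · obtain ⟨w, hw, e⟩ := hψ.exists_norm_lt hφ hconv hz hz0
    rw [e]
    exact hφ.re_pos w (mem_disk.2 (hw.trans (mem_disk.1 hz)))

theorem re_sub_div_pos {z : ℂ} (hz : z ∈ disk) (hz0 : z ≠ 0) :
    0 < ((φ z - ψ z) / (z * deriv φ z)).re := by
  obtain ⟨w, hw, e⟩ := hψ.exists_norm_lt hφ hconv hz hz0
  have := hφ.toUnivalent.re_sub_div_neg_of_convex hconv hz hw
  rw [e, ← neg_sub, neg_div, Complex.neg_re]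
  linarith

/-- The functions `(1 - t) ψ + t φ` form a Löwner chain. -/
theorem re_chain_pos {z : ℂ} (hz : z ∈ disk) (hz0 : z ≠ 0) {t : ℝ} (h0 : 0 ≤ t) (h1 : t ≤ 1) :
    0 < ((φ z - ψ z) / (z * ((1 - t) * deriv ψ z + t * deriv φ z))).re := by
  have hQ := hψ.re_sub_div_pos hφ hconv hz hz0
  have hQ0 : φ z - ψ z ≠ 0 := by intro h; simp [h] at hQ
  -- The reciprocal of the target quotient is `(1 - t) ψ + t z φ' / (φ - ψ)`, a convex combination
  -- of numbers with positive real part.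
  have hP : 0 < ((1 - t : ℝ) * ψ z + (t : ℝ) * ((φ z - ψ z) / (z * deriv φ z))⁻¹).re := by
    rw [Complex.add_re, Complex.re_ofReal_mul, Complex.re_ofReal_mul]
    have a := re_inv_pos hQ
    have b := hψ.re_pos hφ hconv hz
    rcases h0.eq_or_lt with h | h
    · rw [← h]; simpa using b
    · have := mul_pos h a
      have := mul_nonneg (sub_nonneg.2 h1) b.le
      linarith
  convert re_inv_pos hP using 2
  rw [← inv_div]
  congr 1
  have := hψ.mul_deriv hz
  rw [inv_div, div_eq_iff hQ0, add_mul, mul_assoc, mul_assoc, div_mul_cancel₀ _ hQ0, ← this]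
  push_cast
  ring

theorem chain_deriv_ne_zero {z : ℂ} (hz : z ∈ disk) {t : ℝ} (h0 : 0 ≤ t) (h1 : t ≤ 1) :
    (1 - t) * deriv ψ z + t * deriv φ z ≠ 0 := by
  by_cases hz0 : z = 0
  · have h2 := hψ.two_mul_deriv_zero hφ.analytic hφ.map_zero
    have h3 := hφ.toUnivalent.deriv_ne_zero zero_mem_disk
    rw [hz0, ← h2]
    have h4 : deriv ψ 0 ≠ 0 := by intro h; rw [h] at h2; exact h3 (by simpa using h2.symm)
    have h5 : ((1 + t : ℝ) : ℂ) ≠ 0 := by exact_mod_cast (by positivity : 1 + t ≠ 0)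
    have := mul_ne_zero h5 h4
    convert this using 1
    push_cast
    ring
  · intro h
    have := hψ.re_chain_pos hφ hconv hz hz0 h0 h1
    simp [h] at this

/-- This is the implicit function theorem, applied with complex `t` and then restricted to real
parameters. The equivalence encodes local uniqueness of the root, which prevents two distinct roots
from merging. -/
theorem exists_local_branch {a : ℂ} (ha : a ∈ disk) {t : ℝ} (h0 : 0 ≤ t) (h1 : t ≤ 1) :
    ∃ α : ℝ → ℂ, HasDerivAt α (-((φ a - ψ a) / ((1 - t) * deriv ψ a + t * deriv φ a))) t ∧
      ∀ᶠ v : ℝ × ℂ in 𝓝 (t, a),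
        (1 - v.1) * ψ v.2 + v.1 * φ v.2 = (1 - t) * ψ a + t * φ a ↔ α v.1 = v.2 := by
  set Λ := (1 - t) * deriv ψ a + t * deriv φ a with hΛ
  have hΛ0 : Λ ≠ 0 := hψ.chain_deriv_ne_zero hφ hconv ha h0 h1
  set f : ℂ × ℂ → ℂ := fun v => (1 - v.1) * ψ v.2 + v.1 * φ v.2 with hf
  let E : ℂ ≃L[ℂ] ℂ := ContinuousLinearEquiv.unitsEquivAut ℂ (Units.mk0 Λ hΛ0)
  have hE : ∀ x, E x = x * Λ := fun x => rfl
  set f' : ℂ × ℂ →L[ℂ] ℂ := (ContinuousLinearMap.fst ℂ ℂ ℂ).smulRight (φ a - ψ a) +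
    (E : ℂ →L[ℂ] ℂ) ∘L ContinuousLinearMap.snd ℂ ℂ ℂ with hf'
  have dψ : HasStrictFDerivAt (fun v : ℂ × ℂ => ψ v.2)
      (deriv ψ a • ContinuousLinearMap.snd ℂ ℂ ℂ) ((t : ℂ), a) := by
    have h : HasStrictDerivAt ψ (deriv ψ a) ((t : ℂ), a).2 :=
      (hψ.analytic.analyticAt (isOpen_ball.mem_nhds ha)).hasStrictDerivAt
    exact h.comp_hasStrictFDerivAt _ hasStrictFDerivAt_snd
  have dφ : HasStrictFDerivAt (fun v : ℂ × ℂ => φ v.2)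
      (deriv φ a • ContinuousLinearMap.snd ℂ ℂ ℂ) ((t : ℂ), a) := by
    have h : HasStrictDerivAt φ (deriv φ a) ((t : ℂ), a).2 :=
      (hφ.analytic.analyticAt (isOpen_ball.mem_nhds ha)).hasStrictDerivAt
    exact h.comp_hasStrictFDerivAt _ hasStrictFDerivAt_snd
  have dfst : HasStrictFDerivAt (fun v : ℂ × ℂ => v.1) (ContinuousLinearMap.fst ℂ ℂ ℂ)
    ((t : ℂ), a) := hasStrictFDerivAt_fst
  have hfd : HasStrictFDerivAt f f' ((t : ℂ), a) := by
    have := ((dfst.const_sub 1).mul dψ).add (dfst.mul dφ)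
    refine this.congr_fderiv ?_
    ext
    · simp [hf', hE, hΛ]
      ring
    · simp [hf', hE, hΛ]
  have hcomp : f' ∘L ContinuousLinearMap.inr ℂ ℂ ℂ = (E : ℂ →L[ℂ] ℂ) := by
    ext; simp [hf']
  have hinv : (f' ∘L ContinuousLinearMap.inr ℂ ℂ ℂ).IsInvertible := ⟨E, hcomp.symm⟩
  have hα := hfd.hasStrictFDerivAt_implicitFunctionOfProdDomain hinv
  have hiff := hfd.eventually_apply_eq_iff_implicitFunctionOfProdDomain hinv
  set α := hfd.implicitFunctionOfProdDomain hinv with hαdef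
  refine ⟨fun τ => α τ, ?_, ?_⟩
  · have h2 : HasDerivAt α (-((φ a - ψ a) / Λ)) (t : ℂ) := by
      have h3 := hα.hasFDerivAt.hasDerivAt
      refine h3.congr_deriv ?_
      rw [hcomp]
      have hEs : ∀ x, E.symm x = x / Λ := fun x => by
        rw [ContinuousLinearEquiv.symm_apply_eq, hE, div_mul_cancel₀ _ hΛ0]
      simp [ContinuousLinearMap.inverse_equiv, hEs, hf']
    exact h2.comp_ofReal
  · have hcont : Tendsto (fun v : ℝ × ℂ => ((v.1 : ℂ), v.2)) (𝓝 (t, a)) (𝓝 ((t : ℂ), a)) := by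
      have : Continuous (fun v : ℝ × ℂ => ((v.1 : ℂ), v.2)) := by fun_prop
      exact this.tendsto (t, a)
    filter_upwards [hcont.eventually hiff] with v hv using hv

/-- A root of `(1 - t) ψ + t φ = c` moves inward as `t` increases. -/
theorem eventually_exists_root {a : ℂ} (ha : a ∈ disk) {t : ℝ} (h0 : 0 ≤ t) (h1 : t ≤ 1) :
    ∃ α : ℝ → ℂ, ContinuousAt α t ∧ α t = a ∧ ∀ᶠ τ : ℝ in 𝓝[>] t, ‖α τ‖ ≤ ‖a‖ ∧
      (1 - τ) * ψ (α τ) + τ * φ (α τ) = (1 - t) * ψ a + t * φ a := by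
  obtain ⟨α, hα, hiff⟩ := hψ.exists_local_branch hφ hconv ha h0 h1
  have hαt : α t = a := hiff.self_of_nhds.1 rfl
  have hroot : ∀ᶠ τ in 𝓝 t, (1 - τ) * ψ (α τ) + τ * φ (α τ) = (1 - t) * ψ a + t * φ a := by
    have hc : Tendsto (fun τ => (τ, α τ)) (𝓝 t) (𝓝 (t, a)) := by
      have := continuousAt_id.prodMk hα.continuousAt
      simpa only [ContinuousAt, id, hαt] using this
    filter_upwards [hc.eventually hiff] with τ hτ using hτ.2 rfl
  refine ⟨α, hα.continuousAt, hαt, ?_⟩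
  -- All members of the chain agree at `0`, so by local uniqueness a root there stays there. For `a
  -- ≠ 0` the derivative of `‖α‖ ^ 2` is negative by `re_chain_pos`.
  by_cases ha0 : a = 0
  · have hc : Tendsto (fun τ : ℝ => (τ, (0 : ℂ))) (𝓝 t) (𝓝 (t, a)) := by
      rw [ha0]
      have : Continuous (fun τ : ℝ => (τ, (0 : ℂ))) := by fun_prop
      exact this.tendsto t
    filter_upwards [hroot.filter_mono nhdsWithin_le_nhds,
      (hc.eventually hiff).filter_mono nhdsWithin_le_nhds] with τ h2 h3
    refine ⟨?_, h2⟩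
    have : α τ = 0 := by
      refine h3.1 ?_
      simp only [ha0, hψ.map_zero]
      ring
    rw [this, norm_zero]; exact norm_nonneg _
  · have hre := hψ.re_chain_pos hφ hconv ha ha0 h0 h1
    set Λ := (1 - t) * deriv ψ a + t * deriv φ a with hΛ
    have hsq := hα.norm_sq
    have hneg : 2 * inner ℝ (α t) (-((φ a - ψ a) / Λ)) < 0 := by
      rw [hαt, Complex.inner]
      have e : -((φ a - ψ a) / Λ) * (starRingEnd ℂ) a
          = ((-(Complex.normSq a) : ℝ) : ℂ) * ((φ a - ψ a) / (a * Λ)) := by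
        rw [Complex.ofReal_neg, ← Complex.mul_conj a]
        field_simp
      rw [e, Complex.re_ofReal_mul]
      have := Complex.normSq_pos.2 ha0
      nlinarith
    filter_upwards [eventually_lt_of_deriv_neg hsq hneg,
      hroot.filter_mono nhdsWithin_le_nhds] with τ h2 h3
    refine ⟨?_, h3⟩
    rw [hαt] at h2
    exact (pow_le_pow_iff_left₀ (norm_nonneg _) (norm_nonneg _) two_ne_zero).1 h2.le

/-- The solution of the Briot–Bouquet equation is univalent. -/
theorem injOn : InjOn ψ disk := by
  intro z₁ hz₁ z₂ hz₂ he
  by_contra hne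
  set c := ψ z₁ with hc
  set r := max ‖z₁‖ ‖z₂‖ with hr
  have hr1 : r < 1 := max_lt (mem_disk.1 hz₁) (mem_disk.1 hz₂)
  have hsub : closedBall (0 : ℂ) r ⊆ disk := closedBall_subset_ball hr1
  let Λ : ℝ → ℂ → ℂ := fun t z => (1 - t) * ψ z + t * φ z
  -- Continuity method: the parameters at which the value `c` is still taken twice in the fixed
  -- closed disk. The set is closed in `[0, 1]` by compactness and the impossibility of merging, and
  -- it extends to the right because the roots move inward.
  let T : Set ℝ := {t | ∃ p ∈ closedBall (0 : ℂ) r ×ˢ closedBall (0 : ℂ) r,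
    p.1 ≠ p.2 ∧ Λ t p.1 = c ∧ Λ t p.2 = c}
  have hclosed : IsClosed (T ∩ Icc 0 1) := by
    rw [← isOpen_compl_iff, isOpen_iff_mem_nhds]
    intro t ht
    by_cases htI : t ∈ Icc (0 : ℝ) 1
    swap
    · filter_upwards [isClosed_Icc.isOpen_compl.mem_nhds htI] with s hs h using hs h.2
    have htT : t ∉ T := fun h => ht ⟨h, htI⟩
    have hcont : ∀ x ∈ disk, ContinuousAt (fun v : ℝ × ℂ => Λ v.1 v.2) (t, x) := by
      intro x hx
      have c1 : ContinuousAt (fun v : ℝ × ℂ => ψ v.2) (t, x) :=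
        ContinuousAt.comp (g := ψ) (f := Prod.snd)
          (differentiableAt_of_mem_disk hψ.analytic hx).continuousAt continuousAt_snd
      have c2 : ContinuousAt (fun v : ℝ × ℂ => φ v.2) (t, x) :=
        ContinuousAt.comp (g := φ) (f := Prod.snd)
          (differentiableAt_of_mem_disk hφ.analytic hx).continuousAt continuousAt_snd
      have c3 : ContinuousAt (fun v : ℝ × ℂ => (v.1 : ℂ)) (t, x) :=
        (Complex.continuous_ofReal.comp continuous_fst).continuousAt
      exact ((continuousAt_const.sub c3).mul c1).add (c3.mul c2)
    have key : ∀ᶠ s in 𝓝 t, ∀ p ∈ closedBall (0 : ℂ) r ×ˢ closedBall (0 : ℂ) r,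
        ¬ (p.1 ≠ p.2 ∧ Λ s p.1 = c ∧ Λ s p.2 = c) := by
      refine ((isCompact_closedBall _ _).prod
        (isCompact_closedBall _ _)).eventually_forall_of_forall_eventually ?_
      rintro ⟨a, b⟩ ⟨ha, hb⟩
      have p1 : Tendsto (fun v : ℝ × ℂ × ℂ => (v.1, v.2.1)) (𝓝 (t, a, b)) (𝓝 (t, a)) := by
        have : Continuous (fun v : ℝ × ℂ × ℂ => (v.1, v.2.1)) := by fun_prop
        exact this.tendsto (t, a, b)
      have p2 : Tendsto (fun v : ℝ × ℂ × ℂ => (v.1, v.2.2)) (𝓝 (t, a, b)) (𝓝 (t, b)) := by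
        have : Continuous (fun v : ℝ × ℂ × ℂ => (v.1, v.2.2)) := by fun_prop
        exact this.tendsto (t, a, b)
      by_cases hca : Λ t a = c
      · by_cases hcb : Λ t b = c
        · have hab : a = b := by
            by_contra hab
            exact htT ⟨(a, b), ⟨ha, hb⟩, hab, hca, hcb⟩
          subst hab
          obtain ⟨α, -, hiff⟩ := hψ.exists_local_branch hφ hconv (hsub ha) htI.1 htI.2
          filter_upwards [p1.eventually hiff, p2.eventually hiff] with v h1 h2
          rintro ⟨h3, h4, h5⟩
          rw [← hca] at h4 h5
          exact h3 ((h1.1 h4).symm.trans (h2.1 h5))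
        · filter_upwards [p2.eventually ((hcont b (hsub hb)).eventually_ne hcb)] with v hv h
            using hv h.2.2
      · filter_upwards [p1.eventually ((hcont a (hsub ha)).eventually_ne hca)] with v hv h
          using hv h.2.1
    filter_upwards [key] with s hs h
    obtain ⟨p, hp, hh⟩ := h.1
    exact hs p hp hh
  have h0T : (0 : ℝ) ∈ T := by
    refine ⟨(z₁, z₂), ⟨?_, ?_⟩, hne, ?_, ?_⟩
    · simp [hr]
    · simp [hr]
    · simp [Λ, hc]
    · simp [Λ, ← he]
  have h1T : (1 : ℝ) ∈ T := by
    refine hclosed.Icc_subset_of_forall_mem_nhdsWithin h0T ?_ (right_mem_Icc.2 zero_le_one)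
    rintro t ⟨⟨⟨a, b⟩, ⟨ha, hb⟩, hab, hca, hcb⟩, ht⟩
    obtain ⟨α, cα, eα, hα⟩ := hψ.eventually_exists_root hφ hconv (hsub ha) ht.1 ht.2.le
    obtain ⟨β, cβ, eβ, hβ⟩ := hψ.eventually_exists_root hφ hconv (hsub hb) ht.1 ht.2.le
    have hneq : ∀ᶠ τ in 𝓝 t, α τ ≠ β τ := by
      have : ContinuousAt (fun τ => α τ - β τ) t := cα.sub cβ
      filter_upwards [this.eventually_ne (by rw [eα, eβ]; exact sub_ne_zero.2 hab)] with τ hτ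
        using sub_ne_zero.1 hτ
    filter_upwards [hα, hβ, hneq.filter_mono nhdsWithin_le_nhds] with τ h1 h2 h3
    rw [mem_closedBall_zero_iff] at ha hb
    exact ⟨(α τ, β τ), ⟨by simpa using h1.1.trans ha, by simpa using h2.1.trans hb⟩, h3,
      h1.2.trans hca, h2.2.trans hcb⟩
  obtain ⟨⟨a, b⟩, ⟨ha, hb⟩, hab, hca, hcb⟩ := h1T
  simp only [Λ, Complex.ofReal_one, sub_self, zero_mul, one_mul, zero_add] at hca hcb
  exact hab (hφ.univalent (hsub ha) (hsub hb) (hca.trans hcb.symm))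

theorem toUnivalent : Univalent ψ := ⟨hψ.analytic, hψ.injOn hφ hconv⟩

/-- For `f` in the convex class, `z f' / f` is subordinate to the solution of the Briot–Bouquet
equation. -/
theorem exists_schwarz_of_convexClass {f : ℂ → ℂ} (hf : ConvexClass φ f) :
    ∃ ω : ℂ → ℂ, DifferentiableOn ℂ ω disk ∧ ω 0 = 0 ∧ (∀ z ∈ disk, ‖ω z‖ ≤ ‖z‖) ∧
      ∀ z ∈ disk, z * deriv f z = ψ (ω z) * f z := by
  obtain ⟨w, hw, hw0, hwm, hwe⟩ := hf.subordinate
  have hwle : ∀ z ∈ disk, ‖w z‖ ≤ ‖z‖ := fun z hz =>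
    Complex.norm_le_norm_of_mapsTo_ball hw (fun x hx => ball_subset_closedBall (hwm x hx)) hw0
      (mem_disk.1 hz)
  -- The argument uses reciprocals: `u = f / (z f')` is analytic since `f' ≠ 0`, whereas `z f' / f`
  -- would require first excluding zeros of `f` off the origin.
  have hinv : Univalent (fun z => (ψ z)⁻¹) :=
    ⟨hψ.analytic.fun_inv hψ.ne_zero, fun a ha b hb h => hψ.injOn hφ hconv ha hb (inv_injective h)⟩
  have hfd := hf.normalized.analytic
  have hf'd : DifferentiableOn ℂ (deriv f) disk := hfd.deriv isOpen_ball
  set u : ℂ → ℂ := fun z => dslope f 0 z / deriv f z with hu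
  have hud : DifferentiableOn ℂ u disk :=
    ((Complex.differentiableOn_dslope (isOpen_ball.mem_nhds zero_mem_disk)).2 hfd).fun_div hf'd
      hf.deriv_ne_zero
  have hfu : ∀ z ∈ disk, f z = z * deriv f z * u z := by
    intro z hz
    have h1 := sub_smul_dslope f 0 z
    simp only [sub_zero, smul_eq_mul, hf.normalized.map_zero] at h1
    have := hf.deriv_ne_zero z hz
    rw [hu, ← h1]
    field_simp
  have hequ : ∀ z ∈ disk, u z * φ (w z) = 1 - z * deriv u z := by
    intro z hz
    have d1 := (differentiableAt_of_mem_disk hf'd hz).hasDerivAt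
    have d2 := (differentiableAt_of_mem_disk hud hz).hasDerivAt
    have d3 := (((hasDerivAt_id z).fun_mul d1).fun_mul d2)
    have d4 := (differentiableAt_of_mem_disk hfd hz).hasDerivAt
    have := d4.unique (d3.congr_of_eventuallyEq (by
      filter_upwards [isOpen_ball.mem_nhds hz] with x hx using hfu x hx))
    simp only [id] at this
    have h0 := hf.deriv_ne_zero z hz
    rw [← hwe z hz]
    field_simp
    linear_combination -this
  have hu0 : u 0 = (ψ 0)⁻¹ := by
    rw [hψ.map_zero, hφ.map_zero]
    simp [hu, dslope_same, hf.normalized.deriv_zero]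
  obtain ⟨ω, hω, hω0, hωle, hωe⟩ := hinv.exists_schwarz hud hu0 (by
    intro z ζ k hz hζ hz0 hζ0 hk e1 e2
    by_contra! hlt
    have hψζ := hψ.ne_zero ζ hζ
    have hdi : deriv (fun z => (ψ z)⁻¹) ζ = -deriv ψ ζ / ψ ζ ^ 2 :=
      ((differentiableAt_of_mem_disk hψ.analytic hζ).hasDerivAt.fun_inv hψζ).deriv
    have h1 := hequ z hz
    have h2 := hψ.mul_deriv hζ
    -- After division by `ζ φ' ζ` the right side has nonnegative real part by `re_sub_div_pos`. The
    -- left side has negative real part by convexity, since `‖w z‖ ≤ ‖z‖ < ‖ζ‖`.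
    have e3 : φ (w z) - φ ζ = ((k - 1 : ℝ) : ℂ) * (φ ζ - ψ ζ) := by
      rw [e2, hdi, e1] at h1
      have h3 : ζ * (-deriv ψ ζ / ψ ζ ^ 2) = -((φ ζ - ψ ζ) / ψ ζ) := by
        field_simp
        linear_combination -h2
      rw [h3] at h1
      field_simp at h1
      push_cast
      linear_combination h1
    have h3 := hφ.toUnivalent.re_sub_div_neg_of_convex hconv hζ ((hwle z hz).trans_lt hlt)
    rw [e3, mul_div_assoc, Complex.re_ofReal_mul] at h3
    have h4 := hψ.re_sub_div_pos hφ hconv hζ hζ0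
    nlinarith)
  refine ⟨ω, hω, hω0, hωle, fun z hz => ?_⟩
  have hωz : ω z ∈ disk := mem_disk.2 ((hωle z hz).trans_lt (mem_disk.1 hz))
  have := hψ.ne_zero _ hωz
  rw [hfu z hz, hωe z hz]
  field_simp

end BriotBouquetSolution

/-! ### Taylor coefficients -/

theorem taylorCoeff_zero (g : ℂ → ℂ) : taylorCoeff g 0 = g 0 := by simp [taylorCoeff]

theorem taylorCoeff_one (g : ℂ → ℂ) : taylorCoeff g 1 = deriv g 0 := by
  simp [taylorCoeff, iteratedDeriv_one]

theorem taylorCoeff_congr {g h : ℂ → ℂ} (e : g =ᶠ[𝓝 0] h) (m : ℕ) :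
    taylorCoeff g m = taylorCoeff h m := by
  rw [taylorCoeff, taylorCoeff, e.iteratedDeriv_eq]

theorem taylorCoeff_mul {g h : ℂ → ℂ} (hg : AnalyticAt ℂ g 0) (hh : AnalyticAt ℂ h 0) (n : ℕ) :
    taylorCoeff (fun z => g z * h z) n =
      ∑ i ∈ Finset.range (n + 1), taylorCoeff g i * taylorCoeff h (n - i) := by
  rw [taylorCoeff, iteratedDeriv_fun_mul hg.contDiffAt hh.contDiffAt, Finset.sum_div]
  refine Finset.sum_congr rfl fun i hi => ?_
  have hin : i ≤ n := by simpa [Nat.lt_succ_iff] using hi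
  rw [Nat.cast_choose ℂ hin, taylorCoeff, taylorCoeff]
  have h1 : (n.factorial : ℂ) ≠ 0 := by exact_mod_cast n.factorial_ne_zero
  have h2 : (i.factorial : ℂ) ≠ 0 := by exact_mod_cast i.factorial_ne_zero
  have h3 : ((n - i).factorial : ℂ) ≠ 0 := by exact_mod_cast (n - i).factorial_ne_zero
  field_simp

theorem taylorCoeff_const_mul (c : ℂ) (g : ℂ → ℂ) (n : ℕ) :
    taylorCoeff (fun z => c * g z) n = c * taylorCoeff g n := by
  rw [taylorCoeff, iteratedDeriv_const_mul_field, taylorCoeff, mul_div_assoc]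

theorem taylorCoeff_sum {ι : Type*} (s : Finset ι) {g : ι → ℂ → ℂ}
    (hg : ∀ i ∈ s, AnalyticAt ℂ (g i) 0) (n : ℕ) :
    taylorCoeff (fun z => ∑ i ∈ s, g i z) n = ∑ i ∈ s, taylorCoeff (g i) n := by
  rw [taylorCoeff, iteratedDeriv_fun_sum fun i hi => (hg i hi).contDiffAt, Finset.sum_div]
  rfl

theorem taylorCoeff_const_succ (c : ℂ) (n : ℕ) : taylorCoeff (fun _ => c) (n + 1) = 0 := by
  simp [taylorCoeff, iteratedDeriv_const]

theorem taylorCoeff_deriv (g : ℂ → ℂ) (n : ℕ) :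
    taylorCoeff (deriv g) n = (n + 1) * taylorCoeff g (n + 1) := by
  rw [taylorCoeff, taylorCoeff, iteratedDeriv_succ', Nat.factorial_succ]
  have h1 : (n.factorial : ℂ) ≠ 0 := by exact_mod_cast n.factorial_ne_zero
  have h2 : ((n : ℂ) + 1) ≠ 0 := by exact_mod_cast n.succ_ne_zero
  push_cast
  field_simp

theorem taylorCoeff_const_add_succ (c : ℂ) (g : ℂ → ℂ) (n : ℕ) :
    taylorCoeff (fun z => c + g z) (n + 1) = taylorCoeff g (n + 1) := by
  rw [taylorCoeff, iteratedDeriv_const_add n.succ_pos, taylorCoeff]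

theorem taylorCoeff_id_mul_succ {g : ℂ → ℂ} (hg : AnalyticAt ℂ g 0) (n : ℕ) :
    taylorCoeff (fun z => z * g z) (n + 1) = taylorCoeff g n := by
  have hid : AnalyticAt ℂ (fun z : ℂ => z) 0 := analyticAt_id
  rw [taylorCoeff_mul hid hg, Finset.sum_eq_single 1]
  · rw [taylorCoeff_one]; simp
  · intro i _ hi
    rw [taylorCoeff, iteratedDeriv_fun_id_zero, if_neg hi]; simp
  · simp

theorem taylorCoeff_succ_of_eventuallyEq {g k : ℂ → ℂ} {c : ℂ} (hk : AnalyticAt ℂ k 0)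
    (e : ∀ᶠ z in 𝓝 0, g z = c + z * k z) (n : ℕ) : taylorCoeff g (n + 1) = taylorCoeff k n := by
  rw [taylorCoeff_congr e, taylorCoeff_const_add_succ, taylorCoeff_id_mul_succ hk]

theorem eq_add_mul_dslope (g : ℂ → ℂ) (z : ℂ) : g z = g 0 + z * dslope g 0 z := by
  have := sub_smul_dslope g 0 z
  rw [sub_zero, smul_eq_mul] at this
  rw [this]; ring

theorem differentiableOn_dslope_zero {g : ℂ → ℂ} (hg : DifferentiableOn ℂ g disk) :
    DifferentiableOn ℂ (dslope g 0) disk :=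
  (Complex.differentiableOn_dslope (isOpen_ball.mem_nhds zero_mem_disk)).2 hg

theorem analyticAt_zero {g : ℂ → ℂ} (hg : DifferentiableOn ℂ g disk) : AnalyticAt ℂ g 0 :=
  hg.analyticAt (isOpen_ball.mem_nhds zero_mem_disk)

theorem taylorCoeff_dslope {g : ℂ → ℂ} (hg : DifferentiableOn ℂ g disk) (n : ℕ) :
    taylorCoeff (dslope g 0) n = taylorCoeff g (n + 1) :=
  (taylorCoeff_succ_of_eventuallyEq (analyticAt_zero (differentiableOn_dslope_zero hg))
    (Eventually.of_forall (eq_add_mul_dslope g)) n).symm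

theorem differentiableOn_comp_mul {g : ℂ → ℂ} (hg : DifferentiableOn ℂ g disk) {c : ℂ}
    (hc : ‖c‖ ≤ 1) : DifferentiableOn ℂ (fun z => g (c * z)) disk := by
  refine hg.comp (f := fun z => c * z) (by fun_prop) fun z hz => ?_
  rw [mem_disk] at *
  rw [norm_mul]
  nlinarith [norm_nonneg z, norm_nonneg c]

theorem taylorCoeff_comp_mul {c : ℂ} (hc : ‖c‖ ≤ 1) (n : ℕ) {g : ℂ → ℂ}
    (hg : DifferentiableOn ℂ g disk) :
    taylorCoeff (fun z => g (c * z)) n = c ^ n * taylorCoeff g n := by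
  induction n generalizing g with
  | zero => simp [taylorCoeff_zero]
  | succ n ih =>
    have hd := differentiableOn_dslope_zero hg
    rw [taylorCoeff_succ_of_eventuallyEq (k := fun z => c * dslope g 0 (c * z)) (c := g 0)
      (analyticAt_const.mul (analyticAt_zero (differentiableOn_comp_mul hd hc)))
      (Eventually.of_forall fun z => by rw [eq_add_mul_dslope g (c * z)]; ring),
      taylorCoeff_const_mul, ih hd, taylorCoeff_dslope hg]
    ring

/-! ### Mean values over circles -/

theorem circleIntegrable_of_disk {h : ℂ → ℂ} {r : ℝ} (hr : 0 < r) (hr1 : r < 1)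
    (hh : ContinuousOn h disk) : CircleIntegrable h 0 r :=
  (hh.mono (sphere_subset_closedBall.trans (closedBall_subset_ball hr1))).circleIntegrable hr.le

theorem circleAverage_eq_apply_zero {h : ℂ → ℂ} (hh : DifferentiableOn ℂ h disk) {r : ℝ}
    (hr : 0 < r) (hr1 : r < 1) : Real.circleAverage h 0 r = h 0 := by
  refine circleAverage_of_differentiable_on_off_countable countable_empty ?_ ?_
  · rw [abs_of_pos hr]
    exact hh.continuousOn.mono (closedBall_subset_ball hr1)
  · intro z hz
    rw [abs_of_pos hr, sdiff_empty] at hz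
    exact differentiableAt_of_mem_disk hh (ball_subset_ball hr1.le hz)

theorem circleAverage_conj_pow_succ (n : ℕ) {r : ℝ} (hr : 0 < r) (hr1 : r < 1) :
    Real.circleAverage (fun z => (starRingEnd ℂ) z ^ (n + 1)) 0 r = 0 := by
  have hd : DifferentiableOn ℂ (fun z : ℂ => z ^ (n + 1)) disk := by fun_prop
  have h1 := ContinuousLinearMap.circleAverage_comp_comm (Complex.conjCLE : ℂ →L[ℝ] ℂ)
    (circleIntegrable_of_disk hr hr1 hd.continuousOn)
  rw [circleAverage_eq_apply_zero hd hr hr1] at h1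
  simpa [Function.comp_def] using h1

/-- Split `h = h 0 + z * dslope h 0 z`: the constant averages to zero against a positive power of
the conjugate, and `‖z‖ ^ 2 = r ^ 2` on the circle lowers the exponent by one. -/
theorem circleAverage_mul_conj_pow (n : ℕ) {h : ℂ → ℂ} (hh : DifferentiableOn ℂ h disk) {r : ℝ}
    (hr : 0 < r) (hr1 : r < 1) :
    Real.circleAverage (fun z => h z * (starRingEnd ℂ) z ^ n) 0 r =
      r ^ (2 * n) * taylorCoeff h n := by
  induction n generalizing h with
  | zero => simp [taylorCoeff_zero, circleAverage_eq_apply_zero hh hr hr1]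
  | succ n ih =>
    have hd := differentiableOn_dslope_zero hh
    have i1 : CircleIntegrable (fun z => (starRingEnd ℂ) z ^ (n + 1)) 0 r :=
      circleIntegrable_of_disk hr hr1 (by fun_prop)
    have i2 : CircleIntegrable (fun z => dslope h 0 z * (starRingEnd ℂ) z ^ n) 0 r :=
      circleIntegrable_of_disk hr hr1 (hd.continuousOn.mul (by fun_prop))
    have e : EqOn (fun z => h z * (starRingEnd ℂ) z ^ (n + 1)) (fun z =>
        h 0 • (starRingEnd ℂ) z ^ (n + 1) + (r ^ 2 : ℂ) • (dslope h 0 z * (starRingEnd ℂ) z ^ n))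
        (sphere 0 |r|) := by
      intro z hz
      have hz : ‖z‖ = r := by simpa [abs_of_pos hr] using hz
      have hzz : z * (starRingEnd ℂ) z = r ^ 2 := by
        rw [Complex.mul_conj, Complex.normSq_eq_norm_sq, hz]; push_cast; rfl
      simp only [smul_eq_mul]
      rw [← hzz, eq_add_mul_dslope h z]
      ring
    have j1 : CircleIntegrable (fun z => h 0 • (starRingEnd ℂ) z ^ (n + 1)) 0 r := i1.const_smul
    have j2 : CircleIntegrable
        (fun z => (r ^ 2 : ℂ) • (dslope h 0 z * (starRingEnd ℂ) z ^ n)) 0 r := i2.const_smul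
    rw [Real.circleAverage_congr_sphere e, Real.circleAverage_fun_add j1 j2, Real.circleAverage_fun_smul, Real.circleAverage_fun_smul,
      circleAverage_conj_pow_succ n hr hr1, ih hd, taylorCoeff_dslope hh]
    simp only [smul_eq_mul]
    ring

/-- The Taylor polynomial with given coefficients. -/
noncomputable def polySum (a : ℕ → ℂ) (n : ℕ) (z : ℂ) : ℂ := ∑ m ∈ Finset.range n, a m * z ^ m

theorem differentiable_polySum (a : ℕ → ℂ) (n : ℕ) : Differentiable ℂ (polySum a n) := by
  unfold polySum; fun_prop

theorem analyticAt_pow_zero (m : ℕ) : AnalyticAt ℂ (fun z : ℂ => z ^ m) 0 := by fun_prop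

theorem taylorCoeff_pow (m k : ℕ) : taylorCoeff (fun z => z ^ m) k = if k = m then 1 else 0 := by
  induction m generalizing k with
  | zero =>
    cases k with
    | zero => simp [taylorCoeff_zero]
    | succ k => simpa using taylorCoeff_const_succ 1 k
  | succ m ih =>
    cases k with
    | zero => simp [taylorCoeff_zero]
    | succ k =>
      have : (fun z : ℂ => z ^ (m + 1)) = fun z => z * z ^ m := by ext; ring
      rw [this, taylorCoeff_id_mul_succ (analyticAt_pow_zero m), ih]
      simp

theorem taylorCoeff_polySum (a : ℕ → ℂ) {n m : ℕ} (hm : m < n) :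
    taylorCoeff (polySum a n) m = a m := by
  unfold polySum
  have hA : ∀ i ∈ Finset.range n, AnalyticAt ℂ (fun z : ℂ => a i * z ^ i) 0 :=
    fun i _ => by fun_prop
  rw [taylorCoeff_sum _ hA]
  simp only [taylorCoeff_const_mul, taylorCoeff_pow]
  simp [hm]

theorem circleAverage_mul_conj_polySum {h : ℂ → ℂ} (hh : DifferentiableOn ℂ h disk) {r : ℝ}
    (hr : 0 < r) (hr1 : r < 1) (a : ℕ → ℂ) (n : ℕ) :
    Real.circleAverage (fun z => h z * (starRingEnd ℂ) (polySum a n z)) 0 r =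
      ∑ m ∈ Finset.range n, (starRingEnd ℂ) (a m) * (r ^ (2 * m) * taylorCoeff h m) := by
  have e : (fun z => h z * (starRingEnd ℂ) (polySum a n z)) = fun z =>
      ∑ m ∈ Finset.range n, (starRingEnd ℂ) (a m) • (h z * (starRingEnd ℂ) z ^ m) := by
    ext z
    simp only [polySum, map_sum, map_mul, map_pow, Finset.mul_sum, smul_eq_mul]
    exact Finset.sum_congr rfl fun i _ => by ring
  have hi : ∀ m ∈ Finset.range n,
      CircleIntegrable (fun z => (starRingEnd ℂ) (a m) • (h z * (starRingEnd ℂ) z ^ m)) 0 r :=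
    fun m _ => (circleIntegrable_of_disk hr hr1 (hh.continuousOn.mul (by fun_prop))).const_smul
  rw [e, Real.circleAverage_fun_sum hi]
  refine Finset.sum_congr rfl fun m _ => ?_
  rw [Real.circleAverage_fun_smul, circleAverage_mul_conj_pow m hh hr hr1, smul_eq_mul]

/-- The sum of the squares of the first `n` Taylor coefficients. -/
noncomputable def sqSum (n : ℕ) (g : ℂ → ℂ) : ℝ := ∑ m ∈ Finset.range n, ‖taylorCoeff g m‖ ^ 2

theorem sqSum_succ' (n : ℕ) (g : ℂ → ℂ) :
    sqSum (n + 1) g = ∑ m ∈ Finset.range n, ‖taylorCoeff g (m + 1)‖ ^ 2 + ‖g 0‖ ^ 2 := by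
  rw [sqSum, Finset.sum_range_succ', taylorCoeff_zero]

theorem norm_taylorCoeff_sq_le_sqSum {n m : ℕ} (h : m < n) (g : ℂ → ℂ) :
    ‖taylorCoeff g m‖ ^ 2 ≤ sqSum n g :=
  Finset.single_le_sum (f := fun m => ‖taylorCoeff g m‖ ^ 2) (fun _ _ => by positivity)
    (Finset.mem_range.2 h)

/-- Let `G` and `A` be the truncations of `g` and `η g`. The first `n` coefficients of `η G` are
those of `A`, so pairing `η G` with `A` on the circle gives the mean of `‖A‖ ^ 2`. Since `2 Re (η G
conj A) ≤ ‖G‖ ^ 2 + ‖A‖ ^ 2`, that mean is at most the mean of `‖G‖ ^ 2`. -/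
theorem sum_mul_pow_le_of_norm_le_one {η g : ℂ → ℂ} (hη : DifferentiableOn ℂ η disk)
    (hη1 : ∀ z ∈ disk, ‖η z‖ ≤ 1) (hg : DifferentiableOn ℂ g disk) (n : ℕ) {r : ℝ}
    (hr : 0 < r) (hr1 : r < 1) :
    ∑ m ∈ Finset.range n, r ^ (2 * m) * ‖taylorCoeff (fun z => η z * g z) m‖ ^ 2 ≤
      ∑ m ∈ Finset.range n, r ^ (2 * m) * ‖taylorCoeff g m‖ ^ 2 := by
  set a := taylorCoeff (fun z => η z * g z) with ha
  set G := polySum (taylorCoeff g) n with hG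
  set A := polySum a n with hA
  have hGd : DifferentiableOn ℂ G disk := (differentiable_polySum _ _).differentiableOn
  have hAd : DifferentiableOn ℂ A disk := (differentiable_polySum _ _).differentiableOn
  have hηG : ∀ m < n, taylorCoeff (fun z => η z * G z) m = a m := by
    intro m hm
    rw [taylorCoeff_mul (analyticAt_zero hη) (analyticAt_zero hGd), ha,
      taylorCoeff_mul (analyticAt_zero hη) (analyticAt_zero hg)]
    refine Finset.sum_congr rfl fun i _ => ?_
    rw [taylorCoeff_polySum _ (by omega : m - i < n)]
  have e1 := circleAverage_mul_conj_polySum (hη.fun_mul hGd) hr hr1 a n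
  have e2 := circleAverage_mul_conj_polySum hGd hr hr1 (taylorCoeff g) n
  have e3 := circleAverage_mul_conj_polySum hAd hr hr1 a n
  rw [Finset.sum_congr rfl fun m hm => by rw [hηG m (Finset.mem_range.1 hm)]] at e1
  rw [Finset.sum_congr rfl fun m hm => by
    rw [taylorCoeff_polySum _ (Finset.mem_range.1 hm)]] at e2
  rw [Finset.sum_congr rfl fun m hm => by
    rw [taylorCoeff_polySum _ (Finset.mem_range.1 hm)]] at e3
  have hre : ∀ b : ℕ → ℂ, (∑ m ∈ Finset.range n, (starRingEnd ℂ) (b m) *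
      ((r : ℂ) ^ (2 * m) * b m)).re = ∑ m ∈ Finset.range n, r ^ (2 * m) * ‖b m‖ ^ 2 := by
    intro b
    rw [Complex.re_sum]
    refine Finset.sum_congr rfl fun m _ => ?_
    have : (starRingEnd ℂ) (b m) * ((r : ℂ) ^ (2 * m) * b m)
        = ((r ^ (2 * m) * ‖b m‖ ^ 2 : ℝ) : ℂ) := by
      rw [← Complex.normSq_eq_norm_sq, Complex.ofReal_mul, ← Complex.mul_conj]
      push_cast; ring
    rw [this, Complex.ofReal_re]
  have c1 : CircleIntegrable (fun z => η z * G z * (starRingEnd ℂ) (A z)) 0 r :=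
    circleIntegrable_of_disk hr hr1 ((hη.continuousOn.mul hGd.continuousOn).mul
      (Complex.continuous_conj.comp_continuousOn hAd.continuousOn))
  have c2 : CircleIntegrable (fun z => G z * (starRingEnd ℂ) (G z)) 0 r :=
    circleIntegrable_of_disk hr hr1 (hGd.continuousOn.mul
      (Complex.continuous_conj.comp_continuousOn hGd.continuousOn))
  have c3 : CircleIntegrable (fun z => A z * (starRingEnd ℂ) (A z)) 0 r :=
    circleIntegrable_of_disk hr hr1 (hAd.continuousOn.mul
      (Complex.continuous_conj.comp_continuousOn hAd.continuousOn))
  have c4 := ((c2.add c3).sub (c1.add c1))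
  have hav := ContinuousLinearMap.circleAverage_comp_comm Complex.reCLM c4
  rw [Real.circleAverage_sub (c2.add c3) (c1.add c1), Real.circleAverage_add c2 c3,
    Real.circleAverage_add c1 c1, e1, e2, e3] at hav
  have hnn : 0 ≤ Real.circleAverage (Complex.reCLM ∘
      ((fun z => G z * (starRingEnd ℂ) (G z)) + (fun z => A z * (starRingEnd ℂ) (A z)) -
        ((fun z => η z * G z * (starRingEnd ℂ) (A z)) +
          fun z => η z * G z * (starRingEnd ℂ) (A z)))) 0 r := by
    refine Real.circleAverage_nonneg_of_nonneg fun z hz => ?_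
    have hz : ‖z‖ = r := by simpa [abs_of_pos hr] using hz
    have h1 := hη1 z (mem_disk.2 (hz.trans_lt hr1))
    simp only [Function.comp_apply, Pi.add_apply, Pi.sub_apply, Complex.reCLM_apply,
      Complex.sub_re, Complex.add_re, Complex.mul_conj, Complex.ofReal_re,
      Complex.normSq_eq_norm_sq]
    have h2 : (η z * G z * (starRingEnd ℂ) (A z)).re ≤ ‖G z‖ * ‖A z‖ := by
      refine (Complex.re_le_norm _).trans ?_
      rw [norm_mul, norm_mul, RCLike.norm_conj]
      have := mul_le_mul_of_nonneg_right h1 (norm_nonneg (G z))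
      rw [one_mul] at this
      exact mul_le_mul_of_nonneg_right this (norm_nonneg _)
    nlinarith [sq_nonneg (‖G z‖ - ‖A z‖)]
  rw [hav] at hnn
  simp only [Complex.reCLM_apply, Complex.sub_re, Complex.add_re, hre] at hnn
  linarith

/-- Multiplication by a function bounded by `1` does not increase the partial sums of the squares
of the Taylor coefficients. -/
theorem sqSum_mul_le {η g : ℂ → ℂ} (hη : DifferentiableOn ℂ η disk)
    (hη1 : ∀ z ∈ disk, ‖η z‖ ≤ 1) (hg : DifferentiableOn ℂ g disk) (n : ℕ) :
    sqSum n (fun z => η z * g z) ≤ sqSum n g := by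
  have hlim : ∀ b : ℕ → ℝ, Tendsto (fun r : ℝ => ∑ m ∈ Finset.range n, r ^ (2 * m) * b m)
      (𝓝[<] 1) (𝓝 (∑ m ∈ Finset.range n, b m)) := by
    intro b
    have : Continuous (fun r : ℝ => ∑ m ∈ Finset.range n, r ^ (2 * m) * b m) := by fun_prop
    have := this.tendsto 1
    simp only [one_pow, one_mul] at this
    exact this.mono_left nhdsWithin_le_nhds
  refine le_of_tendsto_of_tendsto (hlim _) (hlim _) ?_
  filter_upwards [Ioo_mem_nhdsLT (zero_lt_one' ℝ)] with r hr
  exact sum_mul_pow_le_of_norm_le_one hη hη1 hg n hr.1 hr.2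

theorem norm_taylorCoeff_le_one {η : ℂ → ℂ} (hη : DifferentiableOn ℂ η disk)
    (hη1 : ∀ z ∈ disk, ‖η z‖ ≤ 1) (m : ℕ) : ‖taylorCoeff η m‖ ≤ 1 := by
  have h1 := sqSum_mul_le hη hη1 (differentiableOn_const (1 : ℂ)) (m + 1)
  have h2 := norm_taylorCoeff_sq_le_sqSum m.lt_succ_self (fun z => η z * 1)
  have h3 : sqSum (m + 1) (fun _ => (1 : ℂ)) = 1 := by
    rw [sqSum_succ']
    simp [taylorCoeff_const_succ]
  simp only [mul_one] at h1 h2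
  rw [h3] at h1
  exact (sq_le_one_iff₀ (norm_nonneg _)).1 (h2.trans h1)

/-! ### Coefficients of subordinate functions -/

/-- A Schwarz function: analytic on the disk, with `‖ω z‖ ≤ ‖z‖`. -/
structure IsSchwarz (ω : ℂ → ℂ) : Prop where
  analytic : DifferentiableOn ℂ ω disk
  norm_le : ∀ z ∈ disk, ‖ω z‖ ≤ ‖z‖

namespace IsSchwarz

variable {ω : ℂ → ℂ} (hω : IsSchwarz ω)
include hω

theorem map_zero : ω 0 = 0 := by
  simpa using hω.norm_le 0 zero_mem_disk

theorem mapsTo : MapsTo ω disk disk := fun z hz =>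
  mem_disk.2 ((hω.norm_le z hz).trans_lt (mem_disk.1 hz))

theorem norm_dslope_le {z : ℂ} (hz : z ∈ disk) : ‖dslope ω 0 z‖ ≤ 1 := by
  have := Complex.norm_dslope_le_div_of_mapsTo_ball hω.analytic (R₂ := 1)
    (fun x hx => by rw [hω.map_zero]; exact ball_subset_closedBall (hω.mapsTo hx)) hz
  simpa using this

theorem comp {F : ℂ → ℂ} (hF : DifferentiableOn ℂ F disk) :
    DifferentiableOn ℂ (fun z => F (ω z)) disk :=
  DifferentiableOn.comp hF hω.analytic hω.mapsTo

/-- **Rogosinski's inequality**. -/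
theorem sqSum_comp_le (n : ℕ) {F : ℂ → ℂ} (hF : DifferentiableOn ℂ F disk) :
    sqSum n (fun z => F (ω z)) ≤ sqSum n F := by
  induction n generalizing F with
  | zero => simp [sqSum]
  | succ n ih =>
    have hd := differentiableOn_dslope_zero hF
    have hη := differentiableOn_dslope_zero hω.analytic
    have hk := hη.fun_mul (hω.comp hd)
    -- The factor `ω z / z` is bounded by `1` and can be dropped by `sqSum_mul_le`; what remains is
    -- the same composition for `dslope F 0`, with one coefficient fewer.
    have e : ∀ z, F (ω z) = F 0 + z * (dslope ω 0 z * dslope F 0 (ω z)) := by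
      intro z
      have h1 := eq_add_mul_dslope ω z
      rw [hω.map_zero, zero_add] at h1
      rw [eq_add_mul_dslope F (ω z), ← mul_assoc, ← h1]
    have h1 := (sqSum_mul_le hη (fun z hz => hω.norm_dslope_le hz) (hω.comp hd) n).trans (ih hd)
    rw [sqSum_succ', sqSum_succ', hω.map_zero]
    simp only [sqSum, taylorCoeff_dslope hF] at h1
    rw [Finset.sum_congr rfl fun m _ => by
      rw [taylorCoeff_succ_of_eventuallyEq (analyticAt_zero hk) (Eventually.of_forall e) m]]
    linarith

/-- A function subordinate to a univalent function with convex image has Taylor coefficients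
bounded by the first one of the latter. -/
theorem norm_taylorCoeff_comp_le_of_convex {F : ℂ → ℂ} (hF : Univalent F)
    (hconv : Convex ℝ (F '' disk)) {m : ℕ} (hm : 1 ≤ m) :
    ‖taylorCoeff (fun z => F (ω z)) m‖ ≤ ‖deriv F 0‖ := by
  set g : ℂ → ℂ := fun z => F (ω z) with hg
  have hgd : DifferentiableOn ℂ g disk := hω.comp hF.analytic
  have hm0 : (m : ℂ) ≠ 0 := by exact_mod_cast (by omega : m ≠ 0)
  have hprim := Complex.isPrimitiveRoot_exp m (by omega)
  set ξ := Complex.exp (2 * Real.pi * Complex.I / m) with hξ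
  have hξn : ‖ξ‖ = 1 := hprim.norm'_eq_one (by omega)
  have hξk : ∀ k, ‖ξ ^ k‖ ≤ 1 := fun k => by rw [norm_pow, hξn, one_pow]
  -- Averaging over rotations by `m`-th roots of unity stays in the convex image, keeps the `m`-th
  -- coefficient and kills those of index strictly between `0` and `m`.
  set q : ℂ → ℂ := fun z => (m : ℂ)⁻¹ * ∑ k ∈ Finset.range m, g (ξ ^ k * z) with hq
  have hqd : DifferentiableOn ℂ q disk :=
    (DifferentiableOn.fun_sum fun k _ => differentiableOn_comp_mul hgd (hξk k)).const_mul _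
  have hqm : ∀ z ∈ disk, q z ∈ F '' disk := by
    intro z hz
    have h1 : ∀ k ∈ Finset.range m, g (ξ ^ k * z) ∈ F '' disk := by
      intro k _
      refine mem_image_of_mem F (hω.mapsTo ?_)
      rw [mem_disk, norm_mul, norm_pow, hξn, one_pow, one_mul]
      exact mem_disk.1 hz
    have h2 := hconv.sum_mem (t := Finset.range m) (w := fun _ => (m : ℝ)⁻¹)
      (fun _ _ => by positivity) (by
        rw [Finset.sum_const, Finset.card_range, nsmul_eq_mul]
        exact mul_inv_cancel₀ (by exact_mod_cast (by omega : m ≠ 0))) h1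
    rw [← Finset.smul_sum, Complex.real_smul] at h2
    simpa [hq] using h2
  have hqc : ∀ j, taylorCoeff q j
      = (m : ℂ)⁻¹ * (∑ k ∈ Finset.range m, (ξ ^ j) ^ k) * taylorCoeff g j := by
    intro j
    rw [hq, taylorCoeff_const_mul, taylorCoeff_sum _ fun k _ =>
      analyticAt_zero (differentiableOn_comp_mul hgd (hξk k)), mul_assoc, Finset.sum_mul]
    congr 1
    refine Finset.sum_congr rfl fun k _ => ?_
    rw [taylorCoeff_comp_mul (hξk k) j hgd]
    ring
  have hqj : ∀ j, 0 < j → j < m → taylorCoeff q j = 0 := by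
    intro j hj hjm
    have h1 : ξ ^ j ≠ 1 := hprim.pow_ne_one_of_pos_of_lt hj.ne' hjm
    rw [hqc, geom_sum_eq h1, ← pow_mul, mul_comm j m, pow_mul, hprim.pow_eq_one]
    simp
  have hqmm : taylorCoeff q m = taylorCoeff g m := by
    rw [hqc, hprim.pow_eq_one]
    simp [hm0]
  set W : ℂ → ℂ := fun z => inverse F (q z) with hW
  have hWd : DifferentiableOn ℂ W disk := hF.differentiableOn_inverse.comp hqd hqm
  have hWm : ∀ z ∈ disk, W z ∈ disk := fun z hz => Univalent.inverse_mem (hqm z hz)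
  have hW0 : W 0 = 0 := by
    have : q 0 = F 0 := by simp [hq, hg, hω.map_zero, hm0]
    rw [hW]; simp only; rw [this, hF.inverse_apply zero_mem_disk]
  set E : ℂ → ℂ := fun z => dslope F 0 (W z) with hE
  have hEd : DifferentiableOn ℂ E disk := (differentiableOn_dslope_zero hF.analytic).comp hWd hWm
  have hqW : ∀ j, taylorCoeff q (j + 1) =
      ∑ i ∈ Finset.range (j + 2), taylorCoeff W i * taylorCoeff E (j + 1 - i) := by
    intro j
    rw [← taylorCoeff_mul (analyticAt_zero hWd) (analyticAt_zero hEd)]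
    rw [← taylorCoeff_const_add_succ (F 0) (fun z => W z * E z)]
    refine taylorCoeff_congr ?_ _
    filter_upwards [isOpen_ball.mem_nhds zero_mem_disk] with z hz
    rw [hE]; simp only
    rw [← eq_add_mul_dslope F (W z)]
    exact (Univalent.apply_inverse (hqm z hz)).symm
  have hE0 : taylorCoeff E 0 = deriv F 0 := by
    rw [taylorCoeff_zero, hE]; simp only; rw [hW0, dslope_same]
  have hF0 := hF.deriv_ne_zero zero_mem_disk
  -- As `F'(0) ≠ 0`, the function `W = F⁻¹ ∘ q` inherits the vanishing low coefficients. The `m`-th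
  -- coefficient of `q` is then `F'(0)` times that of `W`, which is bounded by `1`.
  have hWlow : ∀ j < m, taylorCoeff W j = 0 := by
    intro j
    induction j using Nat.strong_induction_on with
    | _ j ih =>
      intro hjm
      rcases j with _ | j
      · rw [taylorCoeff_zero, hW0]
      · have h1 := hqW j
        rw [hqj _ j.succ_pos hjm, Finset.sum_range_succ, Finset.sum_eq_zero fun i hi => by
          rw [ih i (Finset.mem_range.1 hi) ((Finset.mem_range.1 hi).trans hjm), zero_mul]] at h1
        rw [Nat.sub_self, hE0, zero_add] at h1
        exact (mul_eq_zero.1 h1.symm).resolve_right hF0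
  obtain ⟨j, rfl⟩ : ∃ j, m = j + 1 := ⟨m - 1, by omega⟩
  have h1 := hqW j
  rw [hqmm, Finset.sum_range_succ, Finset.sum_eq_zero fun i hi => by
    rw [hWlow i (Finset.mem_range.1 hi), zero_mul], Nat.sub_self, hE0, zero_add] at h1
  rw [h1, norm_mul]
  exact mul_le_of_le_one_left (norm_nonneg _)
    (norm_taylorCoeff_le_one hWd (fun z hz => (mem_disk.1 (hWm z hz)).le) _)

end IsSchwarz

/-! ### Logarithms and the square root transform of starlike functions -/

theorem exists_exp_eq {E : ℂ → ℂ} (hE : DifferentiableOn ℂ E disk) (hE0 : ∀ z ∈ disk, E z ≠ 0)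
    (hE1 : E 0 = 1) :
    ∃ ℓ : ℂ → ℂ, ℓ 0 = 0 ∧ ∀ z ∈ disk, HasDerivAt ℓ (deriv E z / E z) z ∧
      Complex.exp (ℓ z) = E z := by
  obtain ⟨ℓ, hℓ0, hℓ⟩ :=
    ((hE.deriv isOpen_ball).fun_div hE hE0).isExactOn_ball.with_val_at 0 0
  refine ⟨ℓ, hℓ0, fun z hz => ⟨hℓ z hz, ?_⟩⟩
  have hder : ∀ x ∈ disk, HasDerivAt (fun y => E y * Complex.exp (-ℓ y)) 0 x := by
    intro x hx
    have h1 := (differentiableAt_of_mem_disk hE hx).hasDerivAt.fun_mul (hℓ x hx).fun_neg.cexp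
    refine h1.congr_deriv ?_
    have := hE0 x hx
    field_simp
    ring
  have hconst := isOpen_ball.is_const_of_deriv_eq_zero
    (convex_ball (0 : ℂ) 1).isPreconnected
    (fun x hx => (hder x hx).differentiableAt.differentiableWithinAt)
    (fun x hx => (hder x hx).deriv) hz zero_mem_disk
  simp only [hℓ0, hE1, neg_zero, Complex.exp_zero, mul_one] at hconst
  rw [Complex.exp_neg, mul_inv_eq_one₀ (Complex.exp_ne_zero _)] at hconst
  exact hconst.symm

theorem univalent_inv_one_sub : Univalent (fun z : ℂ => (1 - z)⁻¹) := by
  refine ⟨DifferentiableOn.fun_inv (by fun_prop) fun z hz h => ?_, fun a _ b _ h => ?_⟩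
  · rw [mem_disk, ← sub_eq_zero.1 h, norm_one] at hz
    exact lt_irrefl _ hz
  · exact sub_right_injective (inv_injective h)

theorem one_sub_ne_zero {z : ℂ} (hz : z ∈ disk) : 1 - z ≠ 0 := by
  intro h
  rw [mem_disk, ← sub_eq_zero.1 h, norm_one] at hz
  exact lt_irrefl _ hz

theorem sqSum_inv_one_sub (n : ℕ) : sqSum n (fun z : ℂ => (1 - z)⁻¹) = n := by
  have h : ∀ m, taylorCoeff (fun z : ℂ => (1 - z)⁻¹) m = 1 := by
    intro m
    induction m with
    | zero => simp [taylorCoeff_zero]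
    | succ m ih =>
      refine (taylorCoeff_succ_of_eventuallyEq (c := 1)
        (analyticAt_zero univalent_inv_one_sub.analytic) ?_ m).trans ih
      filter_upwards [isOpen_ball.mem_nhds zero_mem_disk] with z hz
      have := one_sub_ne_zero hz
      field_simp
      ring
  simp [sqSum, h]

namespace Univalent

variable {F : ℂ → ℂ} (hF : Univalent F)
include hF

theorem dslope_ne_zero {z : ℂ} (hz : z ∈ disk) : dslope F 0 z ≠ 0 := by
  by_cases hz0 : z = 0
  · rw [hz0, dslope_same]; exact hF.deriv_ne_zero zero_mem_disk
  · intro h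
    have := eq_add_mul_dslope F z
    rw [h, mul_zero, add_zero] at this
    exact hz0 (hF.inj hz zero_mem_disk this)

/-- If the image of `F` is starlike, then the quotient `(F z - F 0) / (z F' z)` has the form
`(1 - v) / (1 + v)` for a Schwarz function `v`. -/
theorem exists_cayley_of_starConvex (hs : StarConvex ℝ (F 0) (F '' disk)) :
    ∃ v, IsSchwarz v ∧ ∀ z ∈ disk,
      v z * (1 + dslope F 0 z / deriv F z) = 1 - dslope F 0 z / deriv F z := by
  set R : ℂ → ℂ := fun z => dslope F 0 z / deriv F z with hR
  have hRd : DifferentiableOn ℂ R disk :=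
    (differentiableOn_dslope_zero hF.analytic).fun_div (hF.analytic.deriv isOpen_ball)
      fun z hz => hF.deriv_ne_zero hz
  have hR0 : R 0 = 1 := by
    simp only [hR, dslope_same]; exact div_self (hF.deriv_ne_zero zero_mem_disk)
  have hRre : ∀ z ∈ disk, 0 ≤ (R z).re := by
    intro z hz
    by_cases hz0 : z = 0
    · rw [hz0, hR0]; simp
    · have h1 := hF.re_sub_div_nonpos_of_starConvex hs hz hz0
      have h2 : (F 0 - F z) / (z * deriv F z) = -R z := by
        have := hF.deriv_ne_zero hz
        simp only [hR]
        rw [eq_add_mul_dslope F z]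
        field_simp
        ring
      rw [h2, Complex.neg_re] at h1
      linarith
  have hR1 : ∀ z ∈ disk, 1 + R z ≠ 0 := by
    intro z hz h
    have := congrArg Complex.re h
    simp at this
    linarith [hRre z hz]
  have hvd : DifferentiableOn ℂ (fun z => (1 - R z) / (1 + R z)) disk :=
    (hRd.const_sub 1).fun_div (hRd.const_add 1) hR1
  refine ⟨fun z => (1 - R z) / (1 + R z), ⟨hvd, fun z hz => ?_⟩, fun z hz => ?_⟩
  · refine Complex.norm_le_norm_of_mapsTo_ball (f := fun z => (1 - R z) / (1 + R z)) hvd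
      (fun x hx => ?_) (by simp [hR0]) (mem_disk.1 hz)
    rw [mem_closedBall_zero_iff, norm_div]
    refine div_le_one_of_le₀ ?_ (norm_nonneg _)
    rw [← pow_le_pow_iff_left₀ (norm_nonneg _) (norm_nonneg _) two_ne_zero,
      ← Complex.normSq_eq_norm_sq, ← Complex.normSq_eq_norm_sq, Complex.normSq_apply,
      Complex.normSq_apply]
    simp only [Complex.sub_re, Complex.add_re, Complex.sub_im, Complex.add_im, Complex.one_re,
      Complex.one_im]
    nlinarith [hRre x hx]
  · exact div_mul_cancel₀ _ (hR1 z hz)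

/-- The square root transform of a starlike function is subordinate to `1 / (1 - z)`. -/
theorem exists_sqrt_of_starConvex (hs : StarConvex ℝ (F 0) (F '' disk)) :
    ∃ h s, DifferentiableOn ℂ h disk ∧ IsSchwarz s ∧ (∀ z ∈ disk, h z = (1 - s z)⁻¹) ∧
      ∀ z ∈ disk, dslope F 0 z = deriv F 0 * h z ^ 2 := by
  obtain ⟨v, hv, hve⟩ := hF.exists_cayley_of_starConvex hs
  have hc := hF.deriv_ne_zero zero_mem_disk
  set E : ℂ → ℂ := fun z => dslope F 0 z / deriv F 0 with hE
  have hDd := differentiableOn_dslope_zero hF.analytic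
  have hEd : DifferentiableOn ℂ E disk := hDd.div_const _
  have hE0 : ∀ z ∈ disk, E z ≠ 0 := fun z hz => div_ne_zero (hF.dslope_ne_zero hz) hc
  obtain ⟨ℓ, hℓ0, hℓ⟩ := exists_exp_eq hEd hE0 (by simp only [hE, dslope_same]; exact div_self hc)
  set h : ℂ → ℂ := fun z => Complex.exp (ℓ z / 2) with hh
  have hder : ∀ z ∈ disk, HasDerivAt h (h z * (deriv E z / E z / 2)) z := fun z hz =>
    ((hℓ z hz).1.div_const 2).cexp
  have hhd : DifferentiableOn ℂ h disk := fun z hz =>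
    (hder z hz).differentiableAt.differentiableWithinAt
  have hEz : ∀ z ∈ disk, z * (deriv E z / E z) = deriv F z / dslope F 0 z - 1 := by
    intro z hz
    have d1 := (differentiableAt_of_mem_disk hF.analytic hz).hasDerivAt
    have d2 := (((hasDerivAt_id z).fun_mul
      (differentiableAt_of_mem_disk hEd hz).hasDerivAt).const_mul (deriv F 0)).const_add (F 0)
    have h1 := d1.unique (d2.congr_of_eventuallyEq (Eventually.of_forall fun x => by
      simp only [hE, id]
      rw [eq_add_mul_dslope F x]
      field_simp))
    have h2 := hE0 z hz
    have h3 : dslope F 0 z = deriv F 0 * E z := by simp only [hE]; field_simp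
    rw [h1, h3]
    simp only [id]
    field_simp
    ring
  obtain ⟨s, hs1, hs0, hsle, hse⟩ := univalent_inv_one_sub.exists_schwarz hhd (by simp [hh, hℓ0]) (by
    intro z ζ k hz hζ hz0 hζ0 hk e1 e2
    have hζ1 := one_sub_ne_zero hζ
    have hdK : deriv (fun z : ℂ => (1 - z)⁻¹) ζ = ((1 - ζ) ^ 2)⁻¹ := by
      have := (((hasDerivAt_id ζ).const_sub 1).fun_inv hζ1).deriv
      simp only [id] at this
      rw [this]; simp
    rw [(hder z hz).deriv, hdK, e1] at e2
    have h1 := hEz z hz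
    have hD := hF.dslope_ne_zero hz
    have hFz := hF.deriv_ne_zero hz
    set R := dslope F 0 z / deriv F z with hR
    have hR0 : R ≠ 0 := div_ne_zero hD hFz
    have h2 : (1 - R) * (1 - ζ) = 2 * R * k * ζ := by
      have h3 : deriv F z / dslope F 0 z = R⁻¹ := by rw [hR, inv_div]
      rw [h3] at h1
      have h4 : (R⁻¹ - 1) * (1 - ζ) = 2 * k * ζ := by
        rw [← h1]
        field_simp at e2
        linear_combination e2
      field_simp at h4
      linear_combination h4
    have h5 := hve z hz
    rw [← hR] at h5
    have hR1 : 1 + R ≠ 0 := by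
      intro h0
      rw [h0, mul_zero] at h5
      have : (2 : ℂ) = 0 := by linear_combination h0 - h5
      norm_num at this
    -- The contact relation reads `(1 - R) / R = 2 k ζ / (1 - ζ)`; in terms of `v = (1 - R) / (1 +
    -- R)` it takes this form. As `‖1 + (k - 1) ζ‖ ≤ k`, it yields `‖ζ‖ ≤ ‖v z‖ ≤ ‖z‖`.
    have h6 : v z * (1 + (k - 1) * ζ) = k * ζ := by
      apply mul_left_cancel₀ hR1
      linear_combination (1 + (k - 1) * ζ) * h5 + h2
    have h7 : ‖1 + ((k : ℂ) - 1) * ζ‖ ≤ k := by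
      have hk1 : ‖(k : ℂ) - 1‖ = k - 1 := by
        rw [← Complex.ofReal_one, ← Complex.ofReal_sub, Complex.norm_real, Real.norm_eq_abs,
          abs_of_nonneg (by linarith)]
      have := norm_add_le (1 : ℂ) (((k : ℂ) - 1) * ζ)
      rw [norm_one, norm_mul, hk1] at this
      have := mul_le_of_le_one_right (sub_nonneg.2 hk) (mem_disk.1 hζ).le
      linarith
    have h8 := congrArg norm h6
    rw [norm_mul, norm_mul, Complex.norm_real, Real.norm_eq_abs, abs_of_pos (by linarith)] at h8
    have h9 := mul_le_mul_of_nonneg_left h7 (norm_nonneg (v z))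
    rw [h8, mul_comm ‖v z‖] at h9
    exact (le_of_mul_le_mul_left h9 (by linarith)).trans (hv.norm_le z hz))
  refine ⟨h, s, hhd, ⟨hs1, hsle⟩, hse, fun z hz => ?_⟩
  have h1 : h z ^ 2 = E z := by
    rw [← (hℓ z hz).2, hh]
    simp only
    rw [← Complex.exp_nat_mul]
    congr 1
    push_cast
    ring
  rw [h1, hE]
  field_simp

end Univalent

namespace IsSchwarz

variable {ω : ℂ → ℂ} (hω : IsSchwarz ω)
include hω

/-- The coefficient bound for functions subordinate to a starlike function. -/
theorem norm_taylorCoeff_comp_le_of_starConvex {F : ℂ → ℂ} (hF : Univalent F)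
    (hs : StarConvex ℝ (F 0) (F '' disk)) (n : ℕ) :
    ‖taylorCoeff (fun z => F (ω z)) (n + 1)‖ ≤ (n + 1) * ‖deriv F 0‖ := by
  obtain ⟨h, s, hhd, hsS, hse, hsq⟩ := hF.exists_sqrt_of_starConvex hs
  set H : ℂ → ℂ := fun z => h (ω z) with hH
  have hHd : DifferentiableOn ℂ H disk := hω.comp hhd
  have hη := differentiableOn_dslope_zero hω.analytic
  have hηH := hη.fun_mul hHd
  have hN : sqSum (n + 1) H ≤ n + 1 := by
    refine (hω.sqSum_comp_le (n + 1) hhd).trans ?_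
    have h1 := hsS.sqSum_comp_le (n + 1) univalent_inv_one_sub.analytic
    rw [sqSum_inv_one_sub] at h1
    have h2 : sqSum (n + 1) h = sqSum (n + 1) (fun z => (1 - s z)⁻¹) := by
      refine Finset.sum_congr rfl fun m _ => ?_
      rw [taylorCoeff_congr (g := h) (h := fun z => (1 - s z)⁻¹)]
      filter_upwards [isOpen_ball.mem_nhds zero_mem_disk] with z hz using hse z hz
    rw [h2]
    exact_mod_cast h1
  have hN' : sqSum (n + 1) (fun z => dslope ω 0 z * H z) ≤ n + 1 :=
    (sqSum_mul_le hη (fun z hz => hω.norm_dslope_le hz) hHd _).trans hN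
  -- The bounded factor `ω z / z` is attached to one copy of `H`. The coefficient becomes a
  -- convolution of two sequences, each with square sum at most `n + 1`.
  have e : ∀ᶠ z in 𝓝 0, F (ω z) = F 0 + z * (deriv F 0 * (dslope ω 0 z * H z * H z)) := by
    filter_upwards [isOpen_ball.mem_nhds zero_mem_disk] with z hz
    have h1 := eq_add_mul_dslope ω z
    rw [hω.map_zero, zero_add] at h1
    rw [eq_add_mul_dslope F (ω z), hsq _ (hω.mapsTo hz)]
    simp only [hH]
    linear_combination (deriv F 0 * h (ω z) ^ 2) * h1
  rw [taylorCoeff_succ_of_eventuallyEq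
    (analyticAt_zero ((hηH.fun_mul hHd).const_mul (deriv F 0))) e,
    taylorCoeff_const_mul, taylorCoeff_mul (analyticAt_zero hηH) (analyticAt_zero hHd), norm_mul,
    mul_comm]
  refine mul_le_mul_of_nonneg_right ?_ (norm_nonneg _)
  set a := taylorCoeff (fun z => dslope ω 0 z * H z)
  set b := taylorCoeff H
  calc ‖∑ i ∈ Finset.range (n + 1), a i * b (n - i)‖
      ≤ ∑ i ∈ Finset.range (n + 1), (‖a i‖ ^ 2 / 2 + ‖b (n - i)‖ ^ 2 / 2) := by
        refine norm_sum_le_of_le _ fun i _ => ?_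
        rw [norm_mul]
        nlinarith [sq_nonneg (‖a i‖ - ‖b (n - i)‖)]
    _ = (∑ i ∈ Finset.range (n + 1), ‖a i‖ ^ 2) / 2 +
        (∑ i ∈ Finset.range (n + 1), ‖b i‖ ^ 2) / 2 := by
        rw [Finset.sum_add_distrib, Finset.sum_div, Finset.sum_div]
        congr 1
        have := Finset.sum_range_reflect (fun i => ‖b i‖ ^ 2 / 2) (n + 1)
        simpa using this
    _ ≤ n + 1 := by
        simp only [sqSum] at hN hN'
        linarith

end IsSchwarz

/-! ### Logarithmic coefficients -/

/-- Logarithmic differentiation gives `p = 1 + z (log (f z / z))'` near `0`, and coefficients are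
compared. The relation for `p` is stated without division, so zeros of `f` need no attention. -/
theorem logCoeff_succ_eq {f p : ℂ → ℂ} (hf : Normalized f) (hp0 : p 0 = 1)
    (hp : ∀ z ∈ disk, z * deriv f z = p z * f z) (n : ℕ) :
    logCoeff f (n + 1) = taylorCoeff p (n + 1) / (2 * (n + 1 : ℕ)) := by
  set D := dslope f 0 with hD
  have hDd : DifferentiableOn ℂ D disk := differentiableOn_dslope_zero hf.analytic
  have hDA := analyticAt_zero hDd
  have hD0 : D 0 = 1 := by rw [hD, dslope_same, hf.deriv_zero]
  have hslit : ∀ᶠ z in 𝓝 0, D z ∈ Complex.slitPlane :=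
    hDA.continuousAt.eventually_mem (by
      rw [hD0]; exact Complex.isOpen_slitPlane.mem_nhds Complex.one_mem_slitPlane)
  have hℓA : AnalyticAt ℂ (fun z => Complex.log (D z)) 0 :=
    hDA.clog (by rw [hD0]; exact Complex.one_mem_slitPlane)
  have e : ∀ᶠ z in 𝓝 0, p z = 1 + z * deriv (fun z => Complex.log (D z)) z := by
    filter_upwards [hslit, isOpen_ball.mem_nhds zero_mem_disk] with z h1 hz
    have dD := (differentiableAt_of_mem_disk hDd hz).hasDerivAt
    rw [(dD.clog h1).deriv]
    by_cases hz0 : z = 0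
    · rw [hz0, hp0]; simp
    have hfz : ∀ x, f x = x * D x := fun x => by
      rw [eq_add_mul_dslope f x, hf.map_zero, zero_add]
    have h2 := (differentiableAt_of_mem_disk hf.analytic hz).hasDerivAt.unique
      (((hasDerivAt_id z).fun_mul dD).congr_of_eventuallyEq (Eventually.of_forall hfz))
    have h3 := hp z hz
    rw [h2, hfz z] at h3
    simp only [id] at h3
    have hDz : D z ≠ 0 := Complex.slitPlane_ne_zero h1
    field_simp
    apply mul_left_cancel₀ hz0
    linear_combination -h3
  have h1 := taylorCoeff_succ_of_eventuallyEq hℓA.deriv e n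
  rw [taylorCoeff_deriv] at h1
  have h2 : ((n : ℂ) + 1) ≠ 0 := by exact_mod_cast n.succ_ne_zero
  rw [h1, logCoeff]
  push_cast
  field_simp
  rfl

/-- Abel summation, with the boundary term `w n` times the difference of partial sums carried
through the induction. It passes from Rogosinski's unweighted sums to the weights `1 / m ^ 2`. -/
theorem sum_mul_le_sum_mul_of_antitone {a b w : ℕ → ℝ} (hw : Antitone w) (hw0 : ∀ n, 0 ≤ w n)
    (h : ∀ n, ∑ i ∈ Finset.range n, a i ≤ ∑ i ∈ Finset.range n, b i) (n : ℕ) :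
    ∑ i ∈ Finset.range n, w i * a i ≤ ∑ i ∈ Finset.range n, w i * b i := by
  have key : ∀ n, w n * (∑ i ∈ Finset.range (n + 1), b i - ∑ i ∈ Finset.range (n + 1), a i) ≤
      ∑ i ∈ Finset.range (n + 1), w i * b i - ∑ i ∈ Finset.range (n + 1), w i * a i := by
    intro n
    induction n with
    | zero => simp [mul_sub]
    | succ n ih =>
      rw [Finset.sum_range_succ b, Finset.sum_range_succ a, Finset.sum_range_succ _ (n + 1),
        Finset.sum_range_succ (fun i => w i * a i) (n + 1)]
      have h1 := mul_le_mul_of_nonneg_right (hw n.le_succ) (sub_nonneg.2 (h (n + 1)))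
      simp only [Nat.succ_eq_add_one] at h1
      linarith
  cases n with
  | zero => simp
  | succ n => linarith [key n, mul_nonneg (hw0 n) (sub_nonneg.2 (h (n + 1)))]

theorem sum_Icc_one_eq_sum_range (g : ℕ → ℝ) (n : ℕ) :
    ∑ m ∈ Finset.Icc 1 n, g m = ∑ i ∈ Finset.range n, g (i + 1) := by
  induction n with
  | zero => simp
  | succ n ih => rw [Finset.sum_Icc_succ_top (by omega), ih, Finset.sum_range_succ]

theorem summable_div_succ_sq {g : ℕ → ℝ} {C : ℝ} (h0 : ∀ m, 0 ≤ g m) (h : ∀ m, g m ≤ C) :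
    Summable (fun m : ℕ => g m / ((m + 1 : ℕ) : ℝ) ^ 2) := by
  have h1 : Summable (fun m : ℕ => C * (1 / ((m + 1 : ℕ) : ℝ) ^ 2)) :=
    ((summable_nat_add_iff 1).2 (Real.summable_one_div_nat_pow.2 one_lt_two)).mul_left C
  refine Summable.of_nonneg_of_le (fun m => div_nonneg (h0 m) (by positivity)) (fun m => ?_) h1
  rw [mul_one_div]
  exact div_le_div_of_nonneg_right (h m) (by positivity)

namespace StarSolution

/-- The solution is `z exp (ℓ z)`, where `ℓ` is the primitive of `(ψ z - 1) / z` vanishing at `0`.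
-/
theorem exists_of_differentiableOn {ψ : ℂ → ℂ} (hψ : DifferentiableOn ℂ ψ disk) (h0 : ψ 0 = 1) :
    ∃ f, StarSolution ψ f := by
  obtain ⟨ℓ, hℓ0, hℓ⟩ := (differentiableOn_dslope_zero hψ).isExactOn_ball.with_val_at 0 0
  have hder : ∀ z ∈ disk, HasDerivAt (fun z => z * Complex.exp (ℓ z))
      (ψ z * Complex.exp (ℓ z)) z := by
    intro z hz
    have := (hasDerivAt_id z).fun_mul (hℓ z hz).cexp
    refine this.congr_deriv ?_
    rw [eq_add_mul_dslope ψ z, h0]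
    simp only [id]
    ring
  refine ⟨fun z => z * Complex.exp (ℓ z), ⟨fun z hz =>
    (hder z hz).differentiableAt.differentiableWithinAt, by simp, ?_⟩, ?_, ?_⟩
  · rw [(hder 0 zero_mem_disk).deriv, hℓ0, h0]; simp
  · exact fun z _ hz0 => mul_ne_zero hz0 (Complex.exp_ne_zero _)
  · intro z hz hz0
    rw [(hder z hz).deriv]
    have := Complex.exp_ne_zero (ℓ z)
    field_simp

variable {φ ψ f : ℂ → ℂ} (hf : StarSolution ψ f)
include hf

theorem mul_deriv {z : ℂ} (hz : z ∈ disk) : z * deriv f z = ψ z * f z := by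
  by_cases hz0 : z = 0
  · rw [hz0, hf.normalized.map_zero]; simp
  · rw [← hf.equation z hz hz0, div_mul_cancel₀ _ (hf.ne_zero z hz hz0)]

/-- Differentiating `z f' = ψ f` gives `1 + z f'' / f' = ψ + z ψ' / ψ = φ`, so the identity serves
as Schwarz function. -/
theorem convexClass (hψ : BriotBouquetSolution φ ψ) (h0 : φ 0 = 1) : ConvexClass φ f := by
  have hne : ∀ z ∈ disk, deriv f z ≠ 0 := by
    intro z hz h
    by_cases hz0 : z = 0
    · rw [hz0, hf.normalized.deriv_zero] at h; exact one_ne_zero h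
    · have := hf.mul_deriv hz
      rw [h, mul_zero] at this
      exact mul_ne_zero (hψ.ne_zero z hz) (hf.ne_zero z hz hz0) this.symm
  refine ⟨hf.normalized, hne, id, differentiableOn_id, rfl, fun z hz => hz, fun z hz => ?_⟩
  by_cases hz0 : z = 0
  · simp [hz0, h0]
  have df := (differentiableAt_of_mem_disk hf.normalized.analytic hz).hasDerivAt
  have ddf := (differentiableAt_of_mem_disk (hf.normalized.analytic.deriv isOpen_ball)
    hz).hasDerivAt
  have dψ := (differentiableAt_of_mem_disk hψ.analytic hz).hasDerivAt
  have h1 := ((hasDerivAt_id z).fun_mul ddf).unique ((dψ.fun_mul df).congr_of_eventuallyEq (by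
    filter_upwards [isOpen_ball.mem_nhds hz] with x hx using hf.mul_deriv hx))
  simp only [id] at h1 ⊢
  rw [← hψ.equation z hz]
  have h2 := hne z hz
  have h3 := hψ.ne_zero z hz
  have h4 := hf.mul_deriv hz
  field_simp
  linear_combination ψ z * h1 - deriv ψ z * h4

end StarSolution

namespace BriotBouquetSolution

variable {φ ψ : ℂ → ℂ} (hψ : BriotBouquetSolution φ ψ) (hφ : IsMaMinda φ)
include hψ hφ

theorem norm_deriv_zero : ‖deriv ψ 0‖ = ‖taylorCoeff φ 1‖ / 2 := by
  rw [taylorCoeff_one, ← hψ.two_mul_deriv_zero hφ.analytic hφ.map_zero, norm_mul]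
  simp

variable (hconv : Convex ℝ (φ '' disk))
include hconv

/-- The logarithmic coefficients of `f` in the convex class are given by the Taylor coefficients
of a function subordinate to `ψ`. -/
theorem exists_norm_logCoeff_eq {f : ℂ → ℂ} (hf : ConvexClass φ f) :
    ∃ ω, IsSchwarz ω ∧ ∀ n, ‖logCoeff f (n + 1)‖ =
      ‖taylorCoeff (fun z => ψ (ω z)) (n + 1)‖ / (2 * (n + 1 : ℕ)) := by
  obtain ⟨ω, hω, hω0, hωle, hωe⟩ := hψ.exists_schwarz_of_convexClass hφ hconv hf
  refine ⟨ω, ⟨hω, hωle⟩, fun n => ?_⟩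
  rw [logCoeff_succ_eq (p := fun z => ψ (ω z)) hf.normalized
    (by rw [hω0, hψ.map_zero, hφ.map_zero]) hωe, norm_div, norm_mul, Complex.norm_natCast]
  simp

theorem norm_logCoeff_succ_le_of_convex (hψc : Convex ℝ (ψ '' disk)) {f : ℂ → ℂ}
    (hf : ConvexClass φ f) (n : ℕ) :
    ‖logCoeff f (n + 1)‖ ≤ ‖taylorCoeff φ 1‖ / (4 * (n + 1 : ℕ)) := by
  obtain ⟨ω, hω, hγ⟩ := hψ.exists_norm_logCoeff_eq hφ hconv hf
  have h1 := hω.norm_taylorCoeff_comp_le_of_convex (hψ.toUnivalent hφ hconv) hψc n.succ_pos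
  rw [hψ.norm_deriv_zero hφ] at h1
  rw [hγ n, show ‖taylorCoeff φ 1‖ / (4 * (n + 1 : ℕ))
    = ‖taylorCoeff φ 1‖ / 2 / (2 * (n + 1 : ℕ)) by ring]
  exact div_le_div_of_nonneg_right h1 (by positivity)

theorem norm_logCoeff_succ_le_of_starConvex (hψs : StarConvex ℝ 1 (ψ '' disk)) {f : ℂ → ℂ}
    (hf : ConvexClass φ f) (n : ℕ) : ‖logCoeff f (n + 1)‖ ≤ ‖taylorCoeff φ 1‖ / 4 := by
  obtain ⟨ω, hω, hγ⟩ := hψ.exists_norm_logCoeff_eq hφ hconv hf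
  have h1 := hω.norm_taylorCoeff_comp_le_of_starConvex (hψ.toUnivalent hφ hconv)
    (by rwa [hψ.map_zero, hφ.map_zero]) n
  rw [hψ.norm_deriv_zero hφ] at h1
  rw [hγ n, div_le_iff₀ (by positivity)]
  push_cast
  linarith

theorem sum_norm_logCoeff_sq_le {f : ℂ → ℂ} (hf : ConvexClass φ f) (n : ℕ) :
    ∑ m ∈ Finset.range n, ‖logCoeff f (m + 1)‖ ^ 2 ≤
      (1 / 4) * ∑ m ∈ Finset.range n, ‖taylorCoeff ψ (m + 1)‖ ^ 2 / ((m + 1 : ℕ) : ℝ) ^ 2 := by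
  obtain ⟨ω, hω, hγ⟩ := hψ.exists_norm_logCoeff_eq hφ hconv hf
  have hw : Antitone (fun m : ℕ => 1 / (4 * ((m + 1 : ℕ) : ℝ) ^ 2)) := by
    intro a b hab
    have : ((a + 1 : ℕ) : ℝ) ≤ ((b + 1 : ℕ) : ℝ) := by exact_mod_cast Nat.succ_le_succ hab
    simp only
    gcongr
  have h := sum_mul_le_sum_mul_of_antitone
    (a := fun m => ‖taylorCoeff (fun z => ψ (ω z)) (m + 1)‖ ^ 2)
    (b := fun m => ‖taylorCoeff ψ (m + 1)‖ ^ 2) hw (fun m => by positivity) (fun k => by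
      have h1 := hω.sqSum_comp_le (k + 1) hψ.analytic
      rw [sqSum_succ', sqSum_succ', hω.map_zero] at h1
      linarith) n
  rw [Finset.mul_sum]
  convert h using 2 with m hm m hm
  · rw [hγ m]; ring
  · ring

/-- The convex coefficient bound with the identity as Schwarz function shows that the `c_m` are
bounded, so the series is dominated by a multiple of `∑ 1 / m ^ 2`. -/
theorem summable_taylorCoeff (hψc : Convex ℝ (ψ '' disk)) :
    Summable (fun m : ℕ => ‖taylorCoeff ψ (m + 1)‖ ^ 2 / ((m + 1 : ℕ) : ℝ) ^ 2) := by
  refine summable_div_succ_sq (C := ‖deriv ψ 0‖ ^ 2) (fun _ => by positivity) fun m => ?_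
  have hid : IsSchwarz (fun z => z) := ⟨differentiableOn_id, fun _ _ => le_rfl⟩
  exact pow_le_pow_left₀ (norm_nonneg _) (hid.norm_taylorCoeff_comp_le_of_convex
    (hψ.toUnivalent hφ hconv) hψc m.succ_pos) 2

end BriotBouquetSolution

end MaMinda

theorem mainTheorem7 (φ ψ : ℂ → ℂ) (hφ : IsMaMinda φ) (hφconv : Convex ℝ (φ '' disk))
    (hψ : BriotBouquetSolution φ ψ) :
    -- the logarithmic coefficient bounds for convex `ψ`
    (Convex ℝ (ψ '' disk) → ∀ f : ℂ → ℂ, ConvexClass φ f →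
      (∀ m : ℕ, 1 ≤ m → ‖logCoeff f m‖ ≤ ‖taylorCoeff φ 1‖ / (4 * m)) ∧
      (∀ n : ℕ, ∑ m ∈ Finset.Icc 1 n, ‖logCoeff f m‖ ^ 2 ≤
        (1 / 4) * ∑ m ∈ Finset.Icc 1 n, ‖taylorCoeff ψ m‖ ^ 2 / (m : ℝ) ^ 2) ∧
      Summable (fun m : ℕ => ‖logCoeff f (m + 1)‖ ^ 2) ∧
      Summable (fun m : ℕ => ‖taylorCoeff ψ (m + 1)‖ ^ 2 / ((m + 1 : ℕ) : ℝ) ^ 2) ∧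
      ∑' m : ℕ, ‖logCoeff f (m + 1)‖ ^ 2 ≤
        (1 / 4) * ∑' m : ℕ, ‖taylorCoeff ψ (m + 1)‖ ^ 2 / ((m + 1 : ℕ) : ℝ) ^ 2) ∧
    -- the bound for `ψ` starlike with respect to `1`
    (StarConvex ℝ 1 (ψ '' disk) → ∀ f : ℂ → ℂ, ConvexClass φ f →
      ∀ m : ℕ, 1 ≤ m → ‖logCoeff f m‖ ≤ ‖taylorCoeff φ 1‖ / 4) ∧
    -- sharpness, for the function `f₀` with `z f₀' / f₀ = ψ`
    (∃ f₀ : ℂ → ℂ, StarSolution ψ f₀) ∧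
    (∀ f₀ : ℂ → ℂ, StarSolution ψ f₀ →
      ConvexClass φ f₀ ∧
      (∀ m : ℕ, 1 ≤ m → logCoeff f₀ m = taylorCoeff ψ m / (2 * m)) ∧
      (Convex ℝ (ψ '' disk) →
        ‖logCoeff f₀ 1‖ = ‖taylorCoeff φ 1‖ / 4 ∧
        (∀ m : ℕ, 1 ≤ m → (‖logCoeff f₀ m‖ = ‖taylorCoeff φ 1‖ / (4 * m) ↔
          ‖taylorCoeff ψ m‖ = ‖taylorCoeff φ 1‖ / 2)) ∧
        ∑' m : ℕ, ‖logCoeff f₀ (m + 1)‖ ^ 2 =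
          (1 / 4) * ∑' m : ℕ, ‖taylorCoeff ψ (m + 1)‖ ^ 2 / ((m + 1 : ℕ) : ℝ) ^ 2) ∧
      (StarConvex ℝ 1 (ψ '' disk) →
        ‖logCoeff f₀ 1‖ = ‖taylorCoeff φ 1‖ / 4 ∧
        (∀ m : ℕ, 1 ≤ m → (‖logCoeff f₀ m‖ = ‖taylorCoeff φ 1‖ / 4 ↔
          ‖taylorCoeff ψ m‖ = m * ‖taylorCoeff φ 1‖ / 2)))) := by
  have succ_of_le : ∀ {P : ℕ → Prop}, (∀ n, P (n + 1)) → ∀ m : ℕ, 1 ≤ m → P m := by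
    intro P h m hm
    obtain ⟨n, rfl⟩ : ∃ n, m = n + 1 := ⟨m - 1, by omega⟩
    exact h n
  refine ⟨fun hψc f hf => ?_, fun hψs f hf => succ_of_le fun n =>
    hψ.norm_logCoeff_succ_le_of_starConvex hφ hφconv hψs hf n,
    StarSolution.exists_of_differentiableOn hψ.analytic (by rw [hψ.map_zero, hφ.map_zero]),
    fun f₀ hf₀ => ?_⟩
  · have hsψ := hψ.summable_taylorCoeff hφ hφconv hψc
    have hle := hψ.sum_norm_logCoeff_sq_le hφ hφconv hf
    have hsum : ∀ n, ∑ m ∈ Finset.range n, ‖logCoeff f (m + 1)‖ ^ 2 ≤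
        (1 / 4) * ∑' m : ℕ, ‖taylorCoeff ψ (m + 1)‖ ^ 2 / ((m + 1 : ℕ) : ℝ) ^ 2 := fun n =>
      (hle n).trans (mul_le_mul_of_nonneg_left
        (hsψ.sum_le_tsum _ fun _ _ => by positivity) (by norm_num))
    have hsγ : Summable (fun m : ℕ => ‖logCoeff f (m + 1)‖ ^ 2) :=
      summable_of_sum_range_le (fun _ => by positivity) hsum
    refine ⟨succ_of_le fun n => hψ.norm_logCoeff_succ_le_of_convex hφ hφconv hψc hf n,
      fun n => ?_, hsγ, hsψ, hsγ.tsum_le_of_sum_range_le hsum⟩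
    rw [sum_Icc_one_eq_sum_range, sum_Icc_one_eq_sum_range]
    exact hle n
  · have hγ : ∀ n, logCoeff f₀ (n + 1) = taylorCoeff ψ (n + 1) / (2 * (n + 1 : ℕ)) :=
      logCoeff_succ_eq hf₀.normalized (by rw [hψ.map_zero, hφ.map_zero])
        fun z hz => hf₀.mul_deriv hz
    have hγn : ∀ n, ‖logCoeff f₀ (n + 1)‖ = ‖taylorCoeff ψ (n + 1)‖ / (2 * (n + 1 : ℕ)) := by
      intro n
      rw [hγ n, norm_div, norm_mul, Complex.norm_natCast]
      simp
    -- For `m = 1` the convex and starlike bounds coincide, and `‖c_1‖ = ‖B_1‖ / 2` attains both.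
    have h1 : ‖logCoeff f₀ 1‖ = ‖taylorCoeff φ 1‖ / 4 := by
      rw [hγn 0, zero_add, taylorCoeff_one, hψ.norm_deriv_zero hφ]
      push_cast
      ring
    refine ⟨hf₀.convexClass hψ hφ.map_zero, succ_of_le hγ, fun _ => ⟨h1, ?_, ?_⟩,
      fun _ => ⟨h1, ?_⟩⟩
    · refine succ_of_le fun n => ?_
      have hn : ((n + 1 : ℕ) : ℝ) ≠ 0 := by positivity
      rw [hγn n, show ‖taylorCoeff φ 1‖ / (4 * (n + 1 : ℕ))
        = ‖taylorCoeff φ 1‖ / 2 / (2 * (n + 1 : ℕ)) by ring]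
      exact div_left_inj' (mul_ne_zero two_ne_zero hn)
    · rw [← tsum_mul_left]
      refine tsum_congr fun n => ?_
      rw [hγn n]
      ring
    · refine succ_of_le fun n => ?_
      rw [hγn n, div_eq_iff (by positivity)]
      constructor <;> intro h <;> rw [h] <;> ring
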